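/- Let $(\xi_k)_{k\in\mathbb{Z}}$ be a stationary Markov chain, defined on a probability space $(\Omega,\mathcal{F},\mathbb{P})$, with values in a measurable space $(S,\mathcal{A})$ and with marginal distribution $\pi_0$ (the law of $\xi_0$). Assume that it is totally ergodic, i.e. for every integer $m\ge 1$ the $m$-th power $\theta^m$ of the shift $\theta$ of the sequence $(\xi_k)_{k\in\mathbb{Z}}$ is ergodic for the law of the sequence. Let $f:S\to\mathbb{R}$ be measurable with $\int f^2\,d\pi_0<\infty$ and $\int f\,d\pi_0=0$, and put $X_i=f(\xi_i)$, $S_n=\sum_{i=1}^n X_i$. Assume that $$\sup_{n\ge 1}\frac{E(S_n^2)}{n}<\infty \qquad\text{and}\qquad \frac{E(S_n\mid \xi_0,\xi_n)}{\sqrt n}\to 0\ \text{ in probability as } n\to\infty .$$ Then the limit $$\sigma^2=\lim_{n\to\infty}\frac{\pi}{2n}\bigl(E|S_n|\bigr)^2$$ exists and is finite, where $\pi=3.14\ldots$; it coincides with $\lim_{n\to\infty}\frac1n E\bigl[(S_n-E(S_n\mid\xi_0,\xi_n))^2\bigr]$, which also exists; and $$\frac{S_n}{\sqrt n}\Rightarrow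 N(0,\sigma^2)$$ in distribution, where $N(0,0)$ is the unit mass at $0$. -/

import Mathlib

open MeasureTheory ProbabilityTheory Filter
open scoped Topology NNReal

/-- The left shift on two-sided sequences. -/
def seqShift {S : Type*} (x : ℤ → S) : ℤ → S := fun k => x (k + 1)

/-- The law, on the space of two-sided sequences, of the process `ξ`. -/
noncomputable def processLaw {Ω S : Type*} [MeasurableSpace Ω] [MeasurableSpace S]
    (ξ : ℤ → Ω → S) (μ : Measure Ω) : Measure (ℤ → S) :=
  μ.map (fun ω k => ξ k ω)

/-- The σ-algebra generated by the variables `ξ k`, `k ≤ n`. -/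
abbrev pastSigma {Ω S : Type*} [MeasurableSpace S] (ξ : ℤ → Ω → S) (n : ℤ) : MeasurableSpace Ω :=
  ⨆ k ≤ n, MeasurableSpace.comap (ξ k) inferInstance

/-- The σ-algebra generated by the pair `(ξ i, ξ j)`. -/
abbrev pairSigma {Ω S : Type*} [MeasurableSpace S] (ξ : ℤ → Ω → S) (i j : ℤ) : MeasurableSpace Ω :=
  MeasurableSpace.comap (fun ω => (ξ i ω, ξ j ω)) inferInstance

/-- `(ξ k)`, `k ∈ ℤ`, is a (strictly) stationary Markov chain under `μ`, with values in an arbitrary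
measurable space: the law of the process is invariant under the shift, and given the whole past up
to time `n` the conditional probabilities of the events `ξ (n + 1) ∈ A` depend only on `ξ n`. -/
structure IsStationaryMarkovChain {Ω S : Type*} [MeasurableSpace Ω] [MeasurableSpace S]
    (ξ : ℤ → Ω → S) (μ : Measure Ω) : Prop where
  measurable : ∀ k, Measurable (ξ k)
  stationary : (processLaw ξ μ).map seqShift = processLaw ξ μ
  markov : ∀ (n : ℤ) (A : Set S), MeasurableSet A →
    μ[(ξ (n + 1) ⁻¹' A).indicator (fun _ => (1 : ℝ)) | pastSigma ξ n]
      =ᵐ[μ] μ[(ξ (n + 1) ⁻¹' A).indicator (fun _ => (1 : ℝ)) |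
        MeasurableSpace.comap (ξ n) inferInstance]

/-- Total ergodicity: every positive power of the shift is ergodic for the law of the process. -/
def IsTotallyErgodic {Ω S : Type*} [MeasurableSpace Ω] [MeasurableSpace S]
    (ξ : ℤ → Ω → S) (μ : Measure Ω) : Prop :=
  ∀ m : ℕ, 1 ≤ m → Ergodic (seqShift^[m]) (processLaw ξ μ)

/-- `S_n = f(ξ_1) + ⋯ + f(ξ_n)`. -/
def partialSum {Ω S : Type*} (f : S → ℝ) (ξ : ℤ → Ω → S) (n : ℕ) (ω : Ω) : ℝ :=
  ∑ i ∈ Finset.Icc 1 n, f (ξ (i : ℤ) ω)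

/-- `E(S_n | ξ_0, ξ_n)`. -/
noncomputable def endpointCondExp {Ω S : Type*} [MeasurableSpace Ω] [MeasurableSpace S]
    (f : S → ℝ) (ξ : ℤ → Ω → S) (μ : Measure Ω) (n : ℕ) : Ω → ℝ :=
  μ[partialSum f ξ n | pairSigma ξ 0 n]

/-! Subtract from each block sum its conditional expectation given the states at both ends. By the
Markov property such a centered block has conditional mean zero given the whole past of its left end
together with the future of its right end (`IsStationaryMarkovChain.condExp_outside_eq_zero`). A
long centered block differs from a centered subblock by a variable that depends only on the outside
of the subblock. Hence consecutive centered blocks are orthogonal, and Pythagoras' theorem holds: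
the squared distance from a long centered block to the sum of its centered subblocks is the
difference of the variances (`integral_centeredBlock_sub_sum_sq`).

Two consequences follow. The variances `a n` of the centered blocks are superadditive, and `a n ≤
E(S_n²) = O(n)`, so `a n / n` converges to its supremum `L` by Fekete's lemma. Moreover, for large
`m` the centered sum up to time `n` is, in `L²` and at scale `√n`, close to the sum of its centered
subblocks of length `m`.

For fixed `m` that sum obeys a central limit theorem by Lindeberg replacement
(`tendsto_integral_exp_sum_of_condExp`). One block at a time, `exp(isD)` gives way to `exp(-s²V/2)`,
where `V` is the conditional variance of the block given its ends; the remaining factors live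
outside the block, so the terms of first and second order integrate to zero. What is left is an
exponential of the average of the `V`'s, which tends to `a m` in `L¹` because the `m`-th power of
the shift is ergodic.

Letting `m` grow gives the limit law `N(0, L)` for the centered sums. Slutsky's lemma and the
hypothesis on `E(S_n | ξ_0, ξ_n)` transfer it to `S_n / √n`. Bounded second moments give convergence
of first absolute moments, and `E|N(0, L)| = √(2L/π)` identifies `L` with the limit in the
statement. -/

/-! ### Conditional expectations and generating π-systems. -/

section CondExp

variable {Ω : Type*}

/-- The σ-algebra `m ⊔ m'` is generated by the intersections `A ∩ B` with `A ∈ m`, `B ∈ m'`. -/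
lemma sup_eq_generateFrom_inter (m m' : MeasurableSpace Ω) :
    m ⊔ m' = MeasurableSpace.generateFrom
      {s | ∃ A B, MeasurableSet[m] A ∧ MeasurableSet[m'] B ∧ s = A ∩ B} := by
  apply le_antisymm
  · refine sup_le (fun A hA => ?_) (fun B hB => ?_)
    · exact MeasurableSpace.measurableSet_generateFrom
        ⟨A, Set.univ, hA, MeasurableSet.univ, by simp⟩
    · exact MeasurableSpace.measurableSet_generateFrom
        ⟨Set.univ, B, MeasurableSet.univ, hB, by simp⟩
  · refine MeasurableSpace.generateFrom_le ?_
    rintro _ ⟨A, B, hA, hB, rfl⟩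
    exact MeasurableSet.inter ((le_sup_left : m ≤ m ⊔ m') _ hA) ((le_sup_right : m' ≤ m ⊔ m') _ hB)

lemma isPiSystem_inter (m m' : MeasurableSpace Ω) :
    IsPiSystem {s : Set Ω | ∃ A B, MeasurableSet[m] A ∧ MeasurableSet[m'] B ∧ s = A ∩ B} := by
  rintro _ ⟨A, B, hA, hB, rfl⟩ _ ⟨A', B', hA', hB', rfl⟩ -
  exact ⟨A ∩ A', B ∩ B', hA.inter hA', hB.inter hB', by
    ext; simp only [Set.mem_inter_iff]; tauto⟩

/-- A function whose integrals over a generating π-system vanish has vanishing conditional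
expectation. -/
lemma condExp_eq_zero_of_generateFrom {H m₀ : MeasurableSpace Ω} {μ : Measure Ω}
    [IsProbabilityMeasure μ] (hH : H ≤ m₀) {C : Set (Set Ω)} (hC : IsPiSystem C)
    (hHC : H = MeasurableSpace.generateFrom C) {W : Ω → ℝ} (hW : Integrable W μ)
    (huniv : ∫ ω, W ω ∂μ = 0)
    (h : ∀ B ∈ C, ∫ ω in B, W ω ∂μ = 0) : μ[W | H] =ᵐ[μ] 0 := by
  have key : ∀ B, MeasurableSet[H] B → ∫ ω in B, W ω ∂μ = 0 := by
    intro B hB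
    induction B, hB using MeasurableSpace.induction_on_inter hHC hC with
    | empty => simp
    | basic t ht => exact h t ht
    | compl t ht iht =>
      -- The family `C` need not contain the whole space, so the total integral is a separate
      -- hypothesis.
      have := integral_add_compl (hH _ ht) hW
      rw [iht, huniv, zero_add] at this
      exact this
    | iUnion F hd hF ih =>
      rw [integral_iUnion (fun i => hH _ (hF i)) hd hW.integrableOn]
      simp [ih]
  symm
  refine ae_eq_condExp_of_forall_setIntegral_eq hH hW (fun _ _ _ => integrableOn_zero)
    (fun s hs _ => ?_) aestronglyMeasurable_zero
  rw [key s hs]; simp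

/-- If two conditional expectations agree on the indicators of a generating π-system, they agree
on all integrable functions that are measurable for the generated σ-algebra. -/
lemma condExp_congr_of_generateFrom {m₁ m₂ H m₀ : MeasurableSpace Ω} {μ : Measure Ω}
    [IsProbabilityMeasure μ]
    (h1 : m₁ ≤ m₀) (h2 : m₂ ≤ m₀)
    (hH : H ≤ m₀) {C : Set (Set Ω)} (hC : IsPiSystem C) (hHC : H = MeasurableSpace.generateFrom C)
    (h : ∀ B ∈ C, μ[B.indicator (fun _ => (1 : ℝ)) | m₂]
      =ᵐ[μ] μ[B.indicator (fun _ => (1 : ℝ)) | m₁])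
    {Z : Ω → ℝ} (hZ : Integrable Z μ) (hZm : AEStronglyMeasurable[H] Z μ) :
    μ[Z | m₂] =ᵐ[μ] μ[Z | m₁] := by
  have key : ∀ B, MeasurableSet[H] B →
      μ[B.indicator (fun _ => (1 : ℝ)) | m₂] =ᵐ[μ] μ[B.indicator (fun _ => (1 : ℝ)) | m₁] := by
    intro B hB
    induction B, hB using MeasurableSpace.induction_on_inter hHC hC with
    | empty => simp
    | basic t ht => exact h t ht
    | compl t ht iht =>
      have e : tᶜ.indicator (fun _ => (1 : ℝ)) = (fun _ => (1 : ℝ)) - t.indicator (fun _ => 1) := by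
        ext ω; by_cases hω : ω ∈ t <;> simp [hω]
      have hi : Integrable (t.indicator (fun _ => (1 : ℝ))) μ :=
        (integrable_const 1).indicator (hH _ ht)
      rw [e]
      refine (condExp_sub (integrable_const 1) hi m₂).trans
        (EventuallyEq.trans ?_ (condExp_sub (integrable_const 1) hi m₁).symm)
      rw [condExp_const h1, condExp_const h2]
      exact EventuallyEq.rfl.sub iht
    | iUnion F hd hF ih =>
      have e : (⋃ i, F i).indicator (fun _ => (1 : ℝ)) =
          fun ω => ∑' i, (F i).indicator (fun _ => (1 : ℝ)) ω := by
        ext ω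
        by_cases hω : ω ∈ ⋃ i, F i
        · obtain ⟨i, hi⟩ := Set.mem_iUnion.1 hω
          rw [tsum_eq_single i, Set.indicator_of_mem hω, Set.indicator_of_mem hi]
          intro j hj
          exact Set.indicator_of_notMem (fun h => Set.disjoint_left.1 (hd hj) h hi) _
        · rw [Set.indicator_of_notMem hω]
          have : ∀ i, (F i).indicator (fun _ => (1 : ℝ)) ω = 0 := fun i =>
            Set.indicator_of_notMem (fun h => hω (Set.mem_iUnion.2 ⟨i, h⟩)) _
          simp [this]
      have hfin : ∑' i, ∫⁻ ω, ‖(F i).indicator (fun _ => (1 : ℝ)) ω‖ₑ ∂μ ≠ ⊤ := by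
        have : ∀ i, ∫⁻ ω, ‖(F i).indicator (fun _ => (1 : ℝ)) ω‖ₑ ∂μ = μ (F i) := by
          intro i
          simp_rw [enorm_indicator_eq_indicator_enorm]
          rw [lintegral_indicator (hH _ (hF i))]; simp
        simp_rw [this]
        rw [← measure_iUnion hd (fun i => hH _ (hF i))]
        exact measure_ne_top _ _
      have hm : ∀ i, AEStronglyMeasurable ((F i).indicator (fun _ => (1 : ℝ))) μ :=
        fun i => aestronglyMeasurable_const.indicator (hH _ (hF i))
      rw [e]
      refine (condExp_tsum hm hfin).trans (EventuallyEq.trans ?_ (condExp_tsum hm hfin).symm)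
      filter_upwards [ae_all_iff.2 ih] with ω hω
      simp [hω]
  revert Z
  intro Z hZ hZm
  refine MemLp.induction_stronglyMeasurable hH ENNReal.one_ne_top
    (fun Z => μ[Z | m₂] =ᵐ[μ] μ[Z | m₁]) ?_ ?_ ?_ ?_ (memLp_one_iff_integrable.2 hZ) hZm
  · intro c s hs _
    have e : s.indicator (fun _ => c) = c • s.indicator (fun _ => (1 : ℝ)) := by
      ext ω; by_cases hω : ω ∈ s <;> simp [hω]
    rw [e]
    exact (condExp_smul c _ m₂).trans (((key s hs).const_smul c).trans (condExp_smul c _ m₁).symm)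
  · intro f g _ hf hg _ _ hf' hg'
    have hf := memLp_one_iff_integrable.1 hf
    have hg := memLp_one_iff_integrable.1 hg
    exact (condExp_add hf hg m₂).trans ((hf'.add hg').trans (condExp_add hf hg m₁).symm)
  -- Closedness in `L¹`: the condition says that two continuous operators agree.
  · have hcl : ∀ f : lpMeas ℝ ℝ H 1 μ, (μ[(f : Ω → ℝ) | m₂] =ᵐ[μ] μ[(f : Ω → ℝ) | m₁]) ↔
        condExpL1CLM ℝ h2 μ (f : Lp ℝ 1 μ) = condExpL1CLM ℝ h1 μ (f : Lp ℝ 1 μ) := by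
      intro f
      have e2 := condExp_ae_eq_condExpL1CLM h2 (L1.integrable_coeFn (f : Lp ℝ 1 μ))
      have e1 := condExp_ae_eq_condExpL1CLM h1 (L1.integrable_coeFn (f : Lp ℝ 1 μ))
      rw [Integrable.toL1_coeFn] at e1 e2
      constructor
      · intro h
        exact Lp.ext (e2.symm.trans (h.trans e1))
      · intro h
        rw [h] at e2
        exact e2.trans e1.symm
    simp_rw [hcl]
    exact isClosed_eq ((condExpL1CLM ℝ h2 μ).continuous.comp continuous_subtype_val)
      ((condExpL1CLM ℝ h1 μ).continuous.comp continuous_subtype_val)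
  · intro f g hfg _ hf
    exact (condExp_congr_ae hfg.symm).trans (hf.trans (condExp_congr_ae hfg))

/-- Pull out the measurable factor, then integrate. Read in both directions, this trades an
indicator for its conditional probability. -/
lemma integral_mul_condExp_eq {m m₀ : MeasurableSpace Ω} {μ : Measure Ω}
    [IsProbabilityMeasure μ] (hm : m ≤ m₀)
    {U g : Ω → ℝ} (hU : StronglyMeasurable[m] U) (hUg : Integrable (U * g) μ)
    (hg : Integrable g μ) : ∫ ω, U ω * g ω ∂μ = ∫ ω, U ω * (μ[g | m]) ω ∂μ := by
  rw [← integral_condExp hm (f := fun ω => U ω * g ω)]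
  exact integral_congr_ae (condExp_mul_of_stronglyMeasurable_left hU hUg hg)

end CondExp

/-! ### The Markov property, one-sided and two-sided. -/

section Markov

variable {Ω S : Type*} [MeasurableSpace S]

/-- The σ-algebra generated by the variables `ξ k`, `a ≤ k ≤ b`. -/
abbrev windowSigma (ξ : ℤ → Ω → S) (a b : ℤ) : MeasurableSpace Ω :=
  ⨆ k ∈ Set.Icc a b, MeasurableSpace.comap (ξ k) inferInstance

variable {ξ : ℤ → Ω → S}

lemma comap_le_windowSigma {a b k : ℤ} (h1 : a ≤ k) (h2 : k ≤ b) :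
    MeasurableSpace.comap (ξ k) inferInstance ≤ windowSigma ξ a b :=
  le_iSup₂_of_le k ⟨h1, h2⟩ le_rfl

lemma comap_le_pastSigma {k n : ℤ} (h : k ≤ n) :
    MeasurableSpace.comap (ξ k) inferInstance ≤ pastSigma ξ n :=
  le_iSup₂_of_le k h le_rfl

lemma windowSigma_mono {a b a' b' : ℤ} (ha : a' ≤ a) (hb : b ≤ b') :
    windowSigma ξ a b ≤ windowSigma ξ a' b' :=
  iSup₂_le fun _ hk => comap_le_windowSigma (ha.trans hk.1) (hk.2.trans hb)

lemma windowSigma_le_pastSigma {a b n : ℤ} (h : b ≤ n) : windowSigma ξ a b ≤ pastSigma ξ n :=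
  iSup₂_le fun _ hk => comap_le_pastSigma (hk.2.trans h)

lemma pastSigma_mono {m n : ℤ} (h : m ≤ n) : pastSigma ξ m ≤ pastSigma ξ n :=
  iSup₂_le fun _ hk => comap_le_pastSigma (le_trans hk h)

lemma pairSigma_eq_sup (i j : ℤ) : pairSigma ξ i j =
    MeasurableSpace.comap (ξ i) inferInstance ⊔ MeasurableSpace.comap (ξ j) inferInstance := by
  exact MeasurableSpace.comap_prodMk (ξ i) (ξ j)

lemma pairSigma_le_windowSigma {a b i j : ℤ} (h1 : a ≤ i) (h2 : i ≤ b) (h3 : a ≤ j) (h4 : j ≤ b) :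
    pairSigma ξ i j ≤ windowSigma ξ a b := by
  rw [pairSigma_eq_sup]
  exact sup_le (comap_le_windowSigma h1 h2) (comap_le_windowSigma h3 h4)

lemma windowSigma_succ {a b : ℤ} (h : a ≤ b) : windowSigma ξ a b =
    MeasurableSpace.comap (ξ a) inferInstance ⊔ windowSigma ξ (a + 1) b := by
  apply le_antisymm
  · refine iSup₂_le fun k hk => ?_
    rcases eq_or_lt_of_le hk.1 with rfl | hk'
    · exact le_sup_left
    · exact le_sup_of_le_right (comap_le_windowSigma (by omega) hk.2)
  · exact sup_le (comap_le_windowSigma le_rfl h) (windowSigma_mono (by omega) le_rfl)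

lemma windowSigma_self (a : ℤ) :
    windowSigma ξ a a = MeasurableSpace.comap (ξ a) inferInstance :=
  le_antisymm (iSup₂_le fun _ hk => by rw [le_antisymm hk.2 hk.1])
    (comap_le_windowSigma le_rfl le_rfl)

variable [MeasurableSpace Ω] {μ : Measure Ω} (hm : ∀ k, Measurable (ξ k))
include hm

lemma windowSigma_le (a b : ℤ) : windowSigma ξ a b ≤ ‹MeasurableSpace Ω› :=
  iSup₂_le fun k _ => (hm k).comap_le

lemma pastSigma_le (n : ℤ) : pastSigma ξ n ≤ ‹MeasurableSpace Ω› :=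
  iSup₂_le fun k _ => (hm k).comap_le

lemma pairSigma_le (i j : ℤ) : pairSigma ξ i j ≤ ‹MeasurableSpace Ω› :=
  ((hm i).prodMk (hm j)).comap_le

omit hm

variable [IsProbabilityMeasure μ]

lemma IsStationaryMarkovChain.condExp_succ (hξ : IsStationaryMarkovChain ξ μ) (n : ℤ) {Z : Ω → ℝ}
    (hZ : Integrable Z μ)
    (hZm : StronglyMeasurable[MeasurableSpace.comap (ξ (n + 1)) inferInstance] Z) :
    μ[Z | pastSigma ξ n] =ᵐ[μ] μ[Z | MeasurableSpace.comap (ξ n) inferInstance] := by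
  refine condExp_congr_of_generateFrom (hξ.measurable n).comap_le (pastSigma_le hξ.measurable n)
    (hξ.measurable (n + 1)).comap_le
    (@MeasurableSpace.isPiSystem_measurableSet Ω
      (MeasurableSpace.comap (ξ (n + 1)) inferInstance))
    (@MeasurableSpace.generateFrom_measurableSet Ω
      (MeasurableSpace.comap (ξ (n + 1)) inferInstance)).symm ?_ hZ hZm.aestronglyMeasurable
  rintro _ ⟨A, hA, rfl⟩
  exact hξ.markov n A hA

/-- The Markov property for events and variables depending on finitely many future times. -/
lemma IsStationaryMarkovChain.condExp_window_aux (hξ : IsStationaryMarkovChain ξ μ) (N : ℕ) :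
    ∀ (a : ℤ) {Z : Ω → ℝ}, Integrable Z μ → StronglyMeasurable[windowSigma ξ a (a + N)] Z →
    μ[Z | pastSigma ξ a] =ᵐ[μ] μ[Z | MeasurableSpace.comap (ξ a) inferInstance] := by
  induction N with
  | zero =>
    intro a Z hZ hZm
    have hZm' : StronglyMeasurable[MeasurableSpace.comap (ξ a) inferInstance] Z := by
      have h : windowSigma ξ a (a + ((0 : ℕ) : ℤ)) = MeasurableSpace.comap (ξ a) inferInstance := by
        rw [Nat.cast_zero, add_zero, windowSigma_self]
      exact h ▸ hZm
    rw [condExp_of_stronglyMeasurable (hξ.measurable a).comap_le hZm' hZ,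
      condExp_of_stronglyMeasurable (pastSigma_le hξ.measurable a)
        (hZm'.mono (comap_le_pastSigma le_rfl)) hZ]
  | succ N ih =>
    intro a Z hZ hZm
    have hle := (hξ.measurable a).comap_le
    have hpa := pastSigma_le hξ.measurable a
    refine condExp_congr_of_generateFrom hle hpa
      (windowSigma_le hξ.measurable _ _) (isPiSystem_inter _ _)
      ((windowSigma_succ (by omega)).trans (sup_eq_generateFrom_inter _ _)) ?_ hZ
      hZm.aestronglyMeasurable
    rintro _ ⟨A, B, hA, hB, rfl⟩
    have hB0 := windowSigma_le hξ.measurable _ _ _ hB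
    have hA0 := hle _ hA
    have hBi : Integrable (B.indicator (fun _ => (1 : ℝ))) μ := (integrable_const 1).indicator hB0
    have hBm : StronglyMeasurable[windowSigma ξ (a + 1) (a + 1 + N)]
        (B.indicator (fun _ => (1 : ℝ))) := by
      have : (a + 1 + N : ℤ) = a + ((N + 1 : ℕ) : ℤ) := by push_cast; ring
      rw [this]
      exact stronglyMeasurable_const.indicator hB
    have h1 := ih (a + 1) hBi hBm
    -- Events of time `a` factor out, so only `B`, which lies in the future from `a + 1`, matters.
    -- The tower property through the past of `a + 1`, the induction hypothesis and one Markov step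
    -- give `q`; being measurable at time `a`, it is also the conditional expectation given `ξ a`.
    set q := μ[μ[B.indicator (fun _ => (1 : ℝ)) | MeasurableSpace.comap (ξ (a + 1)) inferInstance] |
      MeasurableSpace.comap (ξ a) inferInstance] with hq
    have h2 : μ[B.indicator (fun _ => (1 : ℝ)) | pastSigma ξ a] =ᵐ[μ] q :=
      (condExp_condExp_of_le (pastSigma_mono (by omega : a ≤ a + 1))
        (pastSigma_le hξ.measurable (a + 1))).symm.trans ((condExp_congr_ae h1).trans
          (hξ.condExp_succ a integrable_condExp stronglyMeasurable_condExp))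
    have h3 : μ[B.indicator (fun _ => (1 : ℝ)) | MeasurableSpace.comap (ξ a) inferInstance]
        =ᵐ[μ] q := by
      refine (condExp_condExp_of_le (comap_le_pastSigma le_rfl) hpa).symm.trans
        ((condExp_congr_ae h2).trans ?_)
      rw [condExp_of_stronglyMeasurable hle stronglyMeasurable_condExp integrable_condExp]
    have e : (A ∩ B).indicator (fun _ => (1 : ℝ)) =
        A.indicator (fun _ => (1 : ℝ)) * B.indicator (fun _ => 1) := by
      ext ω
      by_cases h1 : ω ∈ A <;> by_cases h2 : ω ∈ B <;> simp [h1, h2]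
    have hi : Integrable (A.indicator (fun _ => (1 : ℝ)) * B.indicator (fun _ => (1 : ℝ))) μ := by
      rw [← e]; exact (integrable_const 1).indicator (hA0.inter hB0)
    have hAm : StronglyMeasurable[MeasurableSpace.comap (ξ a) inferInstance]
        (A.indicator (fun _ => (1 : ℝ))) := stronglyMeasurable_const.indicator hA
    rw [e]
    refine (condExp_mul_of_stronglyMeasurable_left (hAm.mono (comap_le_pastSigma le_rfl)) hi
      hBi).trans (EventuallyEq.trans ?_ (condExp_mul_of_stronglyMeasurable_left hAm hi hBi).symm)
    exact EventuallyEq.rfl.mul (h2.trans h3.symm)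

lemma IsStationaryMarkovChain.condExp_window (hξ : IsStationaryMarkovChain ξ μ) {a b : ℤ}
    (hab : a ≤ b) {Z : Ω → ℝ} (hZ : Integrable Z μ)
    (hZm : StronglyMeasurable[windowSigma ξ a b] Z) :
    μ[Z | pastSigma ξ a] =ᵐ[μ] μ[Z | MeasurableSpace.comap (ξ a) inferInstance] := by
  obtain ⟨N, rfl⟩ := Int.le.dest hab
  exact hξ.condExp_window_aux N a hZ hZm

/-- A variable that depends on `ξ a, …, ξ b` and is centered given `(ξ a, ξ b)` is centered given
the whole past of `a` together with the future of `b`. -/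
lemma IsStationaryMarkovChain.condExp_outside_eq_zero (hξ : IsStationaryMarkovChain ξ μ)
    {a b c : ℤ} (hab : a ≤ b) (hbc : b ≤ c) {W : Ω → ℝ} (hW : Integrable W μ)
    (hWm : StronglyMeasurable[windowSigma ξ a b] W) (hW0 : μ[W | pairSigma ξ a b] =ᵐ[μ] 0) :
    μ[W | pastSigma ξ a ⊔ windowSigma ξ b c] =ᵐ[μ] 0 := by
  have hpa := pastSigma_le hξ.measurable
  have hwi := windowSigma_le hξ.measurable
  have hpair := pairSigma_le hξ.measurable a b
  refine condExp_eq_zero_of_generateFrom (sup_le (hpa a) (hwi b c)) (isPiSystem_inter _ _)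
    (sup_eq_generateFrom_inter _ _) hW ?_ ?_
  · rw [← integral_condExp hpair, integral_congr_ae hW0]; simp
  rintro _ ⟨A, B, hA, hB, rfl⟩
  have hA0 := hpa a _ hA
  have hB0 := hwi b c _ hB
  set IA : Ω → ℝ := A.indicator (fun _ => 1) with hIA
  set IB : Ω → ℝ := B.indicator (fun _ => 1) with hIB
  have hIAi : Integrable IA μ := (integrable_const 1).indicator hA0
  have hIBi : Integrable IB μ := (integrable_const 1).indicator hB0
  have hIAm : StronglyMeasurable[pastSigma ξ a] IA := stronglyMeasurable_const.indicator hA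
  have hIBm : StronglyMeasurable[windowSigma ξ b c] IB := stronglyMeasurable_const.indicator hB
  have bound : ∀ C : Set Ω, ∀ᵐ ω ∂μ, |C.indicator (fun _ => (1 : ℝ)) ω| ≤ 1 := by
    intro C
    refine Eventually.of_forall fun ω => ?_
    by_cases h : ω ∈ C <;> simp [h]
  set z := μ[IB | MeasurableSpace.comap (ξ b) inferInstance] with hz
  set y := μ[IA | MeasurableSpace.comap (ξ a) inferInstance] with hy
  have hzb : ∀ᵐ ω ∂μ, ‖z ω‖ ≤ 1 := ae_bdd_abs_condExp_of_ae_bdd_abs (bound B)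
  have hyb : ∀ᵐ ω ∂μ, ‖y ω‖ ≤ 1 := ae_bdd_abs_condExp_of_ae_bdd_abs (bound A)
  have hAb : ∀ᵐ ω ∂μ, ‖IA ω‖ ≤ 1 := bound A
  have hBb : ∀ᵐ ω ∂μ, ‖IB ω‖ ≤ 1 := bound B
  have hzm : StronglyMeasurable[MeasurableSpace.comap (ξ b) inferInstance] z :=
    stronglyMeasurable_condExp
  have hym : StronglyMeasurable[MeasurableSpace.comap (ξ a) inferInstance] y :=
    stronglyMeasurable_condExp
  have hz0 : AEStronglyMeasurable z μ := integrable_condExp.aestronglyMeasurable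
  have hy0 : AEStronglyMeasurable y μ := integrable_condExp.aestronglyMeasurable
  have hAW : Integrable (IA * W) μ := hW.bdd_mul hIAi.aestronglyMeasurable hAb
  have hAWB : Integrable (IA * W * IB) μ := hAW.mul_bdd hIBi.aestronglyMeasurable hBb
  have hWz : Integrable (W * z) μ := hW.mul_bdd hz0 hzb
  have hAWz : Integrable (IA * (W * z)) μ := hWz.bdd_mul hIAi.aestronglyMeasurable hAb
  have hyWz : Integrable (y * (W * z)) μ := hWz.bdd_mul hy0 hyb
  set q := μ[W * z | MeasurableSpace.comap (ξ a) inferInstance] with hq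
  have hqi : Integrable q μ := integrable_condExp
  have hqA : Integrable (q * IA) μ := hqi.mul_bdd hIAi.aestronglyMeasurable hAb
  -- The indicator of the future event `B` is traded for a function `z` of `ξ b`, then that of the
  -- past event `A` for a function `y` of `ξ a`. The factor `y * z` left in front of `W` depends on
  -- the two ends only, and `W` is centered given these.
  calc ∫ ω in A ∩ B, W ω ∂μ = ∫ ω, (IA * W) ω * IB ω ∂μ := by
        rw [← integral_indicator (hA0.inter hB0)]
        refine integral_congr_ae (Eventually.of_forall fun ω => ?_)
        by_cases h1 : ω ∈ A <;> by_cases h2 : ω ∈ B <;> simp [hIA, hIB, h1, h2]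
    _ = ∫ ω, (IA * W) ω * (μ[IB | pastSigma ξ b]) ω ∂μ :=
        integral_mul_condExp_eq (hpa b) ((hIAm.mono (pastSigma_mono hab)).mul
          (hWm.mono (windowSigma_le_pastSigma le_rfl))) hAWB hIBi
    _ = ∫ ω, IA ω * (W * z) ω ∂μ := by
        refine integral_congr_ae ?_
        filter_upwards [hξ.condExp_window hbc hIBi hIBm] with ω hω
        rw [hω]; simp only [Pi.mul_apply, hz]; ring
    _ = ∫ ω, IA ω * (μ[W * z | pastSigma ξ a]) ω ∂μ :=
        integral_mul_condExp_eq (hpa a) hIAm hAWz hWz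
    -- Conditioning `W * z` on the past of `a` yields a function of `ξ a`; by symmetry of
    -- conditional expectation `IA` may then be averaged given `ξ a` as well. The forward Markov
    -- property thus suffices, with no time reversal.
    _ = ∫ ω, q ω * IA ω ∂μ := by
        refine integral_congr_ae ?_
        filter_upwards [hξ.condExp_window hab hWz
          (hWm.mul (hzm.mono (comap_le_windowSigma hab le_rfl)))] with ω hω
        rw [hω, mul_comm]
    _ = ∫ ω, q ω * y ω ∂μ :=
        integral_mul_condExp_eq (hξ.measurable a).comap_le stronglyMeasurable_condExp hqA hIAi
    _ = ∫ ω, y ω * q ω ∂μ := by simp_rw [mul_comm]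
    _ = ∫ ω, y ω * (W * z) ω ∂μ :=
        (integral_mul_condExp_eq (hξ.measurable a).comap_le hym hyWz hWz).symm
    _ = ∫ ω, (y * z) ω * W ω ∂μ := by
        refine integral_congr_ae (Eventually.of_forall fun ω => ?_)
        simp only [Pi.mul_apply]; ring
    _ = ∫ ω, (y * z) ω * (μ[W | pairSigma ξ a b]) ω ∂μ := by
        refine integral_mul_condExp_eq hpair ?_ ?_ hW
        · refine (hym.mono ?_).mul (hzm.mono ?_) <;> rw [pairSigma_eq_sup]
          · exact le_sup_left
          · exact le_sup_right
        · convert! hyWz using 1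
          ext ω; simp only [Pi.mul_apply]; ring
    _ = 0 := by
        rw [integral_congr_ae (g := 0)]
        · simp
        · filter_upwards [hW0] with ω hω
          simp [hω]

end Markov

lemma integrable_mul_of_memLp_two {Ω : Type*} [MeasurableSpace Ω] {μ : Measure Ω} {f g : Ω → ℝ}
    (hf : MemLp f 2 μ) (hg : MemLp g 2 μ) : Integrable (fun ω => f ω * g ω) μ :=
  hf.integrable_mul hg

/-! ### Stationarity and translates of the path. -/

section Stationary

variable {Ω S : Type*}

lemma seqShift_iterate (m : ℕ) (x : ℤ → S) : seqShift^[m] x = fun j => x (j + m) := by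
  induction m generalizing x with
  | zero => simp
  | succ m ih =>
    rw [Function.iterate_succ_apply, ih]
    ext j
    simp only [seqShift]
    congr 1
    push_cast
    ring

variable [MeasurableSpace S]

lemma measurable_seqShift : Measurable (seqShift : (ℤ → S) → ℤ → S) :=
  measurable_pi_lambda _ fun k => measurable_pi_apply (k + 1)

/-- The trajectory seen from time `k`. -/
def pathFrom (ξ : ℤ → Ω → S) (k : ℕ) (ω : Ω) : ℤ → S := fun j => ξ (j + k) ω

variable {ξ : ℤ → Ω → S} [MeasurableSpace Ω] {μ : Measure Ω}

/-- All statistics of blocks become integrals over one path law, hence independent of the position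
of the block. -/
lemma IsStationaryMarkovChain.measurePreserving_pathFrom (hξ : IsStationaryMarkovChain ξ μ)
    (k : ℕ) : MeasurePreserving (pathFrom ξ k) μ (processLaw ξ μ) := by
  have hm : Measurable fun ω j => ξ j ω := measurable_pi_lambda _ hξ.measurable
  have h0 : MeasurePreserving (fun ω j => ξ j ω) μ (processLaw ξ μ) := ⟨hm, rfl⟩
  have h1 : MeasurePreserving seqShift (processLaw ξ μ) (processLaw ξ μ) :=
    ⟨measurable_seqShift, hξ.stationary⟩
  convert! (h1.iterate k).comp h0 using 1
  ext ω : 1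
  rw [Function.comp_apply, seqShift_iterate]
  rfl

lemma IsStationaryMarkovChain.integral_pathFrom (hξ : IsStationaryMarkovChain ξ μ) (k : ℕ)
    {E : Type*} [NormedAddCommGroup E] [NormedSpace ℝ E]
    {F : (ℤ → S) → E} (hF : StronglyMeasurable F) :
    ∫ ω, F (pathFrom ξ k ω) ∂μ = ∫ x, F x ∂(processLaw ξ μ) := by
  have hp := hξ.measurePreserving_pathFrom k
  rw [← hp.map_eq, integral_map hp.measurable.aemeasurable hF.aestronglyMeasurable]

lemma IsStationaryMarkovChain.memLp_pathFrom_iff (hξ : IsStationaryMarkovChain ξ μ) (k : ℕ)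
    {F : (ℤ → S) → ℝ} (hF : StronglyMeasurable F) {p : ENNReal} :
    MemLp (fun ω => F (pathFrom ξ k ω)) p μ ↔ MemLp F p (processLaw ξ μ) := by
  have hp := hξ.measurePreserving_pathFrom k
  rw [← hp.map_eq, memLp_map_measure_iff hF.aestronglyMeasurable hp.measurable.aemeasurable]
  rfl

variable [IsProbabilityMeasure μ]

lemma IsStationaryMarkovChain.isProbabilityMeasure_processLaw (hξ : IsStationaryMarkovChain ξ μ) :
    IsProbabilityMeasure (processLaw ξ μ) :=
  Measure.isProbabilityMeasure_map (measurable_pi_lambda _ hξ.measurable).aemeasurable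

/-- Conditional expectations given the endpoints of a block are given by the same function for
all translates of the block. -/
lemma IsStationaryMarkovChain.exists_condExp_pathFrom (hξ : IsStationaryMarkovChain ξ μ) (m : ℕ)
    {F : (ℤ → S) → ℝ} (hF : StronglyMeasurable F) (hFi : Integrable F (processLaw ξ μ)) :
    ∃ g : S × S → ℝ, StronglyMeasurable g ∧ ∀ k : ℕ,
      μ[fun ω => F (pathFrom ξ k ω) | pairSigma ξ k (k + m)]
        =ᵐ[μ] fun ω => g (ξ k ω, ξ (k + m) ω) := by
  have hpm := hξ.measurePreserving_pathFrom
  -- The factorization is chosen for the block at time `0`. The set integrals that characterize a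
  -- conditional expectation are transported by stationarity, so the same `g` serves every `k`.
  obtain ⟨g, hg, hg0⟩ := (stronglyMeasurable_condExp (μ := μ) (m := pairSigma ξ 0 m)
    (f := fun ω => F (pathFrom ξ 0 ω))).exists_eq_measurable_comp
  refine ⟨g, hg, fun k => ?_⟩
  let pr : (ℤ → S) → S × S := fun x => (x 0, x m)
  have hpr : Measurable pr := (measurable_pi_apply 0).prodMk (measurable_pi_apply _)
  have hpk : ∀ (k : ℕ) ω, pr (pathFrom ξ k ω) = (ξ k ω, ξ (k + m) ω) := by
    intro k ω
    simp [pr, pathFrom, add_comm]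
  have hgpr : StronglyMeasurable (fun x => g (pr x)) := hg.comp_measurable hpr
  have hgi0 : Integrable (fun ω => g (pr (pathFrom ξ 0 ω))) μ := by
    have : (fun ω => g (pr (pathFrom ξ 0 ω))) =
        μ[fun ω => F (pathFrom ξ 0 ω) | pairSigma ξ 0 m] := by
      rw [hg0]; ext ω; rw [hpk 0 ω]; simp
    rw [this]; exact integrable_condExp
  have hgi : Integrable (fun x => g (pr x)) (processLaw ξ μ) :=
    (hpm 0).integrable_comp hgpr.aestronglyMeasurable |>.1 hgi0
  have hset : ∀ (k : ℕ) {G : (ℤ → S) → ℝ}, StronglyMeasurable G → ∀ {B : Set (S × S)},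
      MeasurableSet B →
      ∫ ω in pathFrom ξ k ⁻¹' (pr ⁻¹' B), G (pathFrom ξ k ω) ∂μ
        = ∫ x in pr ⁻¹' B, G x ∂(processLaw ξ μ) := by
    intro k G hG B hB
    rw [← (hpm k).map_eq, setIntegral_map (hpr hB) hG.aestronglyMeasurable
      (hpm k).measurable.aemeasurable]
  symm
  refine ae_eq_condExp_of_forall_setIntegral_eq (pairSigma_le hξ.measurable _ _)
    ((hpm k).integrable_comp hF.aestronglyMeasurable |>.2 hFi) ?_ ?_ ?_
  · intro s _ _
    have := ((hpm k).integrable_comp hgpr.aestronglyMeasurable |>.2 hgi).integrableOn (s := s)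
    refine this.congr (Eventually.of_forall fun ω => ?_)
    simp only [Function.comp_apply, hpk]
  · rintro _ ⟨B, hB, rfl⟩ _
    have e : (fun ω => (ξ k ω, ξ (k + m) ω)) ⁻¹' B = pathFrom ξ k ⁻¹' (pr ⁻¹' B) := by
      ext ω; simp only [Set.mem_preimage, hpk]
    have e0 : (fun ω => (ξ 0 ω, ξ m ω)) ⁻¹' B = pathFrom ξ 0 ⁻¹' (pr ⁻¹' B) := by
      ext ω; simp only [Set.mem_preimage, hpk]; simp
    have h1 := setIntegral_condExp (pairSigma_le hξ.measurable 0 m)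
        ((hpm 0).integrable_comp hF.aestronglyMeasurable |>.2 hFi) ⟨B, hB, rfl⟩
    have h2 : μ[F ∘ pathFrom ξ 0 | pairSigma ξ 0 m] = g ∘ fun ω => (ξ 0 ω, ξ m ω) := hg0
    rw [h2, e0] at h1
    have h3 := hset k hgpr hB
    rw [← hset 0 hgpr hB] at h3
    simp only [hpk, Nat.cast_zero, zero_add] at h3
    rw [e, hset k hF hB, ← hset 0 hF hB]
    exact h3.trans h1
  · exact (hg.comp_measurable (Measurable.of_comap_le le_rfl)).aestronglyMeasurable

end Stationary

/-! ### Centered blocks and their orthogonality. -/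

section Blocks

variable {Ω S : Type*}

/-- `f(ξ_{i+1}) + ⋯ + f(ξ_j)`. -/
def blockSum (f : S → ℝ) (ξ : ℤ → Ω → S) (i j : ℕ) (ω : Ω) : ℝ :=
  ∑ l ∈ Finset.Ioc i j, f (ξ (l : ℤ) ω)

lemma partialSum_eq_blockSum (f : S → ℝ) (ξ : ℤ → Ω → S) (n : ℕ) :
    partialSum f ξ n = blockSum f ξ 0 n := rfl

lemma blockSum_add_blockSum (f : S → ℝ) (ξ : ℤ → Ω → S) {i j k : ℕ} (hij : i ≤ j) (hjk : j ≤ k)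
    (ω : Ω) : blockSum f ξ i j ω + blockSum f ξ j k ω = blockSum f ξ i k ω := by
  unfold blockSum
  rw [← Finset.sum_union, Finset.Ioc_union_Ioc_eq_Ioc hij hjk]
  exact Finset.Ioc_disjoint_Ioc_of_le le_rfl

lemma blockSum_pathFrom (f : S → ℝ) (ξ : ℤ → Ω → S) (k m : ℕ) (ω : Ω) :
    blockSum f ξ k (k + m) ω = ∑ l ∈ Finset.Ioc 0 m, f (pathFrom ξ k ω l) := by
  unfold blockSum
  have h := Finset.map_add_left_Ioc 0 m k
  rw [add_zero] at h
  rw [← h, Finset.sum_map]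
  simp [pathFrom, add_comm]

variable [MeasurableSpace S]

lemma stronglyMeasurable_blockSum {f : S → ℝ} {ξ : ℤ → Ω → S} (hf : Measurable f) {a b : ℤ}
    {i j : ℕ} (hi : a ≤ i + 1) (hj : j ≤ b) :
    StronglyMeasurable[windowSigma ξ a b] (blockSum f ξ i j) := by
  refine Finset.stronglyMeasurable_fun_sum _ fun l hl => ?_
  rw [Finset.mem_Ioc] at hl
  have : StronglyMeasurable[MeasurableSpace.comap (ξ l) inferInstance] (fun ω => f (ξ l ω)) :=
    (hf.comp (Measurable.of_comap_le le_rfl)).stronglyMeasurable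
  exact this.mono (comap_le_windowSigma (by omega) (by omega))

variable [MeasurableSpace Ω]

/-- The block sum centered by its conditional expectation given the states at both ends. -/
noncomputable def centeredBlock (f : S → ℝ) (ξ : ℤ → Ω → S) (μ : Measure Ω) (i j : ℕ) : Ω → ℝ :=
  blockSum f ξ i j - μ[blockSum f ξ i j | pairSigma ξ i j]

/-- The variance of the centered block of length `n` started at time `0`. -/
noncomputable def centeredVar (f : S → ℝ) (ξ : ℤ → Ω → S) (μ : Measure Ω) (n : ℕ) : ℝ :=
  ∫ ω, centeredBlock f ξ μ 0 n ω ^ 2 ∂μ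

variable {f : S → ℝ} {ξ : ℤ → Ω → S} {μ : Measure Ω}

lemma stronglyMeasurable_centeredBlock (hf : Measurable f) {a b : ℤ} {i j : ℕ} (hij : i ≤ j)
    (hi : a ≤ i) (hj : j ≤ b) : StronglyMeasurable[windowSigma ξ a b] (centeredBlock f ξ μ i j) :=
  (stronglyMeasurable_blockSum hf (by omega) hj).sub (stronglyMeasurable_condExp.mono
    (pairSigma_le_windowSigma hi (by omega) (by omega) hj))

variable [IsProbabilityMeasure μ] (hξ : IsStationaryMarkovChain ξ μ) (hf : Measurable f)
  (hf2 : MemLp f 2 (μ.map (ξ 0)))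
include hξ hf hf2

omit [IsProbabilityMeasure μ] in
lemma memLp_comp (l : ℕ) : MemLp (fun ω => f (ξ l ω)) 2 μ := by
  have h0 : MeasurePreserving (ξ 0) μ (μ.map (ξ 0)) := ⟨hξ.measurable 0, rfl⟩
  have hF : StronglyMeasurable fun x : ℤ → S => f (x 0) :=
    (hf.comp (measurable_pi_apply 0)).stronglyMeasurable
  have h1 : MemLp (fun ω => f (pathFrom ξ 0 ω 0)) 2 μ := by
    simpa [pathFrom, Function.comp_def] using hf2.comp_measurePreserving h0
  simpa [pathFrom] using
    (hξ.memLp_pathFrom_iff l hF).2 ((hξ.memLp_pathFrom_iff 0 hF).1 h1)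

omit [IsProbabilityMeasure μ] in
lemma memLp_blockSum (i j : ℕ) : MemLp (blockSum f ξ i j) 2 μ :=
  memLp_finsetSum _ fun l _ => memLp_comp hξ hf hf2 l

omit [IsProbabilityMeasure μ] in
lemma memLp_centeredBlock (i j : ℕ) : MemLp (centeredBlock f ξ μ i j) 2 μ :=
  (memLp_blockSum hξ hf hf2 i j).sub ((memLp_blockSum hξ hf hf2 i j).condExp one_le_two)

lemma condExp_centeredBlock_pair (i j : ℕ) :
    μ[centeredBlock f ξ μ i j | pairSigma ξ i j] =ᵐ[μ] 0 := by
  have hi := (memLp_blockSum hξ hf hf2 i j).integrable one_le_two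
  refine (condExp_sub hi integrable_condExp _).trans ?_
  rw [condExp_of_stronglyMeasurable (pairSigma_le hξ.measurable _ _) stronglyMeasurable_condExp
    integrable_condExp]
  exact Eventually.of_forall fun ω => by simp

/-- A centered block is orthogonal to everything that depends only on the outside of the block. -/
lemma integral_centeredBlock_mul_eq_zero {i j : ℕ} (hij : i ≤ j) {c : ℤ} (hc : j ≤ c)
    {G : Ω → ℝ} (hG : MemLp G 2 μ)
    (hGm : StronglyMeasurable[pastSigma ξ i ⊔ windowSigma ξ j c] G) :
    ∫ ω, G ω * centeredBlock f ξ μ i j ω ∂μ = 0 := by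
  have hY := memLp_centeredBlock hξ hf hf2 i j
  rw [integral_mul_condExp_eq (sup_le (pastSigma_le hξ.measurable i)
    (windowSigma_le hξ.measurable j c)) hGm (hG.integrable_mul hY) (hY.integrable one_le_two)]
  rw [integral_congr_ae (g := 0)]
  · simp
  · filter_upwards [hξ.condExp_outside_eq_zero (by omega : (i : ℤ) ≤ j) hc
      (hY.integrable one_le_two) (stronglyMeasurable_centeredBlock hf hij le_rfl le_rfl)
      (condExp_centeredBlock_pair hξ hf hf2 i j)] with ω hω
    simp [hω]

lemma integral_centeredBlock_mul_centeredBlock {p q i j : ℕ} (hpq : p ≤ q) (hqi : q ≤ i)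
    (hij : i ≤ j) :
    ∫ ω, centeredBlock f ξ μ p q ω * centeredBlock f ξ μ i j ω ∂μ = 0 :=
  integral_centeredBlock_mul_eq_zero hξ hf hf2 hij le_rfl (memLp_centeredBlock hξ hf hf2 p q)
    (((stronglyMeasurable_centeredBlock hf hpq le_rfl le_rfl).mono
      (windowSigma_le_pastSigma (by omega))).mono le_sup_left)

/-- The scalar product of a centered block with the centered block of a longer interval. -/
lemma integral_centeredBlock_mul_subblock {n i j : ℕ} (hij : i ≤ j) (hjn : j ≤ n) :
    ∫ ω, centeredBlock f ξ μ 0 n ω * centeredBlock f ξ μ i j ω ∂μ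
      = ∫ ω, centeredBlock f ξ μ i j ω ^ 2 ∂μ := by
  have hY := memLp_centeredBlock hξ hf hf2 i j
  -- `G` is the long centered block minus the centered subblock: the sums before `i` and after `j`,
  -- and functions of the pairs of endpoint states. All of it is measurable outside the subblock,
  -- hence orthogonal to it.
  set G : Ω → ℝ := blockSum f ξ 0 i + blockSum f ξ j n - μ[blockSum f ξ 0 n | pairSigma ξ 0 n]
    + μ[blockSum f ξ i j | pairSigma ξ i j] with hG
  have hGL : MemLp G 2 μ :=
    (((memLp_blockSum hξ hf hf2 _ _).add (memLp_blockSum hξ hf hf2 _ _)).sub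
      ((memLp_blockSum hξ hf hf2 _ _).condExp one_le_two)).add
      ((memLp_blockSum hξ hf hf2 _ _).condExp one_le_two)
  have hij' : (i : ℤ) ≤ j := by omega
  have h0 : (0 : ℤ) ≤ i := by omega
  have hjn' : (j : ℤ) ≤ n := by omega
  have hGm : StronglyMeasurable[pastSigma ξ i ⊔ windowSigma ξ j n] G := by
    refine @StronglyMeasurable.add _ _ _ (_) _ _ _ _ (@StronglyMeasurable.sub _ _ _ (_) _ _ _ _
      (@StronglyMeasurable.add _ _ _ (_) _ _ _ _ ?_ ?_) ?_) ?_
    · exact ((stronglyMeasurable_blockSum hf (a := 0) (by omega) le_rfl).mono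
        (windowSigma_le_pastSigma le_rfl)).mono le_sup_left
    · exact (stronglyMeasurable_blockSum hf (by omega) le_rfl).mono le_sup_right
    · refine stronglyMeasurable_condExp.mono ?_
      rw [pairSigma_eq_sup]
      exact sup_le_sup (comap_le_pastSigma h0) (comap_le_windowSigma hjn' le_rfl)
    · refine stronglyMeasurable_condExp.mono ?_
      rw [pairSigma_eq_sup]
      exact sup_le_sup (comap_le_pastSigma le_rfl) (comap_le_windowSigma le_rfl hjn')
  have e : ∀ ω, centeredBlock f ξ μ 0 n ω * centeredBlock f ξ μ i j ω
      = centeredBlock f ξ μ i j ω ^ 2 + G ω * centeredBlock f ξ μ i j ω := by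
    intro ω
    have h1 := blockSum_add_blockSum f ξ (Nat.zero_le i) (hij.trans hjn) ω
    have h2 := blockSum_add_blockSum f ξ hij hjn ω
    have : centeredBlock f ξ μ 0 n ω = centeredBlock f ξ μ i j ω + G ω := by
      simp only [centeredBlock, hG, Pi.sub_apply, Pi.add_apply]
      rw [← h1, ← h2]
      simp only [Nat.cast_zero]
      ring
    rw [this]; ring
  simp_rw [e]
  rw [integral_add hY.integrable_sq (integrable_mul_of_memLp_two hGL hY),
    integral_centeredBlock_mul_eq_zero hξ hf hf2 hij hjn' hGL hGm, add_zero]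

/-- Pythagoras' theorem for consecutive centered blocks. -/
lemma integral_centeredBlock_sub_sum_sq {n : ℕ} {p : ℕ → ℕ} (hp : Monotone p) {u : ℕ}
    (hu : p u ≤ n) :
    ∫ ω, (centeredBlock f ξ μ 0 n ω
        - ∑ k ∈ Finset.range u, centeredBlock f ξ μ (p k) (p (k + 1)) ω) ^ 2 ∂μ
      = centeredVar f ξ μ n
        - ∑ k ∈ Finset.range u, ∫ ω, centeredBlock f ξ μ (p k) (p (k + 1)) ω ^ 2 ∂μ := by
  have hL := memLp_centeredBlock hξ hf hf2
  induction u with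
  | zero => simp [centeredVar]
  | succ u ih =>
    have hpu := hp (Nat.le_succ u)
    set R : Ω → ℝ := fun ω => centeredBlock f ξ μ 0 n ω
        - ∑ k ∈ Finset.range u, centeredBlock f ξ μ (p k) (p (k + 1)) ω with hR
    set Y := centeredBlock f ξ μ (p u) (p (u + 1)) with hY
    have hYL : MemLp Y 2 μ := hL _ _
    have hRL : MemLp R 2 μ := (hL 0 n).sub (memLp_finsetSum _ fun k _ => hL _ _)
    -- `Y` is orthogonal to the blocks already subtracted, and its product with the long block
    -- integrates to its own square. So subtracting it lowers the second moment by exactly that of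
    -- `Y`.
    have hRY : ∫ ω, R ω * Y ω ∂μ = ∫ ω, Y ω ^ 2 ∂μ := by
      simp_rw [hR, sub_mul, Finset.sum_mul]
      rw [integral_sub (integrable_mul_of_memLp_two (hL 0 n) hYL)
        (integrable_finsetSum _ fun k _ => integrable_mul_of_memLp_two (hL _ _) hYL),
        integral_centeredBlock_mul_subblock hξ hf hf2 hpu hu,
        integral_finsetSum _ fun k _ => integrable_mul_of_memLp_two (hL _ _) hYL,
        Finset.sum_eq_zero, sub_zero]
      intro k hk
      rw [Finset.mem_range] at hk
      exact integral_centeredBlock_mul_centeredBlock hξ hf hf2 (hp (Nat.le_succ k)) (hp hk) hpu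
    have e : ∀ ω, (centeredBlock f ξ μ 0 n ω - ∑ k ∈ Finset.range (u + 1),
        centeredBlock f ξ μ (p k) (p (k + 1)) ω) ^ 2 = R ω ^ 2 - 2 * (R ω * Y ω) + Y ω ^ 2 := by
      intro ω
      rw [Finset.sum_range_succ]
      simp only [hR, hY]
      ring
    simp_rw [e]
    have h2 : Integrable (fun ω => 2 * (R ω * Y ω)) μ :=
      (integrable_mul_of_memLp_two hRL hYL).const_mul 2
    have h3 : Integrable (fun ω => R ω ^ 2 - 2 * (R ω * Y ω)) μ := hRL.integrable_sq.sub h2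
    rw [integral_add h3 hYL.integrable_sq,
      integral_sub hRL.integrable_sq h2, integral_const_mul, hRY, ih (hpu.trans hu),
      Finset.sum_range_succ]
    ring

/-- All centered blocks of length `m` are given by one and the same functional of the path. -/
lemma exists_centeredBlock_eq_pathFrom (m : ℕ) :
    ∃ D : (ℤ → S) → ℝ, StronglyMeasurable D ∧ MemLp D 2 (processLaw ξ μ) ∧
      ∀ k : ℕ, centeredBlock f ξ μ k (k + m) =ᵐ[μ] fun ω => D (pathFrom ξ k ω) := by
  set F : (ℤ → S) → ℝ := fun x => ∑ l ∈ Finset.Ioc 0 m, f (x l) with hFdef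
  have hF : StronglyMeasurable F := Finset.stronglyMeasurable_fun_sum _ fun l _ =>
    (hf.comp (measurable_pi_apply _)).stronglyMeasurable
  have hFk : ∀ k, blockSum f ξ k (k + m) = fun ω => F (pathFrom ξ k ω) := fun k =>
    funext (blockSum_pathFrom f ξ k m)
  have hp := hξ.measurePreserving_pathFrom
  have hFi : Integrable F (processLaw ξ μ) := by
    rw [← (hp 0).integrable_comp hF.aestronglyMeasurable]
    have := (memLp_blockSum hξ hf hf2 0 (0 + m)).integrable one_le_two
    rwa [hFk 0] at this
  obtain ⟨g, hg, hgk⟩ := hξ.exists_condExp_pathFrom m hF hFi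
  have hD : StronglyMeasurable (fun x : ℤ → S => F x - g (x 0, x m)) :=
    hF.sub (hg.comp_measurable ((measurable_pi_apply _).prodMk (measurable_pi_apply _)))
  have hDk : ∀ k : ℕ, centeredBlock f ξ μ k (k + m) =ᵐ[μ]
      fun ω => F (pathFrom ξ k ω) - g (pathFrom ξ k ω 0, pathFrom ξ k ω m) := by
    intro k
    have h := hgk k
    rw [← hFk k] at h
    unfold centeredBlock
    rw [Nat.cast_add]
    filter_upwards [h] with ω hω
    rw [Pi.sub_apply, hω, hFk k]
    simp [pathFrom, add_comm]
  refine ⟨_, hD, ?_, hDk⟩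
  exact (hξ.memLp_pathFrom_iff 0 hD).1 ((memLp_centeredBlock hξ hf hf2 0 (0 + m)).ae_eq (hDk 0))

/-- Stationarity: blocks of equal length are one functional `D` read along translates of the path.
-/
lemma integral_centeredBlock_sq (k m : ℕ) :
    ∫ ω, centeredBlock f ξ μ k (k + m) ω ^ 2 ∂μ = centeredVar f ξ μ m := by
  obtain ⟨D, hD, -, hDk⟩ := exists_centeredBlock_eq_pathFrom hξ hf hf2 m
  have h : ∀ k : ℕ, ∫ ω, centeredBlock f ξ μ k (k + m) ω ^ 2 ∂μ = ∫ x, D x ^ 2 ∂processLaw ξ μ := by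
    intro k
    have hi := hξ.integral_pathFrom k (hD.pow 2)
    simp only [Pi.pow_apply] at hi
    rw [← hi]
    refine integral_congr_ae ?_
    filter_upwards [hDk k] with ω hω
    rw [hω]
  rw [h k, centeredVar, ← h 0, zero_add]

end Blocks

/-- Fekete's lemma for nonnegative superadditive sequences of linear growth. -/
lemma exists_tendsto_div_of_superadditive {a : ℕ → ℝ} (h0 : ∀ n, 0 ≤ a n)
    (hadd : ∀ i j, a i + a j ≤ a (i + j)) {C : ℝ} (hC : ∀ n : ℕ, 1 ≤ n → a n / n ≤ C) :
    ∃ L : ℝ≥0, Tendsto (fun n : ℕ => a n / n) atTop (𝓝 (L : ℝ)) ∧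
      ∀ n : ℕ, 1 ≤ n → a n / n ≤ L := by
  have hsub : Subadditive fun n => -a n := fun i j => by
    have := hadd i j
    linarith
  -- The range below includes `n = 0`, where the quotient is `0` by convention; `-C` bounds it
  -- because `C` is nonnegative.
  have hC0 : 0 ≤ C := (div_nonneg (h0 1) (Nat.cast_nonneg 1)).trans (hC 1 le_rfl)
  have hb : BddBelow (Set.range fun n : ℕ => -a n / n) := by
    refine ⟨-C, ?_⟩
    rintro _ ⟨n, rfl⟩
    rcases Nat.eq_zero_or_pos n with rfl | hn
    · simpa using hC0
    · have := hC n hn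
      simp only [neg_div]
      linarith
  have ht : Tendsto (fun n : ℕ => a n / n) atTop (𝓝 (-hsub.lim)) := by
    simpa [neg_div] using (hsub.tendsto_lim hb).neg
  have hL : 0 ≤ -hsub.lim := ge_of_tendsto' ht fun n => div_nonneg (h0 n) (Nat.cast_nonneg n)
  lift -hsub.lim to ℝ≥0 using hL with L hL'
  refine ⟨L, ht, fun n hn => ?_⟩
  have := hsub.lim_le_div hb (n := n) (by omega)
  rw [neg_div] at this
  linarith

/-! ### Growth of the variances of centered blocks. -/

section Variance

variable {Ω S : Type*} [MeasurableSpace Ω] [MeasurableSpace S]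
  {f : S → ℝ} {ξ : ℤ → Ω → S} {μ : Measure Ω}

lemma centeredVar_nonneg (n : ℕ) : 0 ≤ centeredVar f ξ μ n :=
  integral_nonneg fun _ => sq_nonneg _

variable [IsProbabilityMeasure μ] (hξ : IsStationaryMarkovChain ξ μ) (hf : Measurable f)
  (hf2 : MemLp f 2 (μ.map (ξ 0)))
include hξ hf hf2

/-- The defect is, by Pythagoras, the second moment of the long block minus its two parts. -/
lemma centeredVar_add_le (i j : ℕ) :
    centeredVar f ξ μ i + centeredVar f ξ μ j ≤ centeredVar f ξ μ (i + j) := by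
  let p : ℕ → ℕ := fun k => if k = 0 then 0 else if k = 1 then i else i + j
  have hp : Monotone p := by
    refine monotone_nat_of_le_succ fun k => ?_
    rcases k with _ | _ | k <;> simp [p]
  have h := integral_centeredBlock_sub_sum_sq hξ hf hf2 (n := i + j) hp (u := 2) (by simp [p])
  have h0 : p 0 = 0 := rfl
  have h1 : p 1 = i := rfl
  have h2 : p 2 = i + j := rfl
  have hi := integral_centeredBlock_sq hξ hf hf2 0 i
  rw [zero_add] at hi
  simp only [Finset.sum_range_succ, Finset.sum_range_zero, zero_add, h0, h1,
    show 1 + 1 = 2 from rfl, h2, hi, integral_centeredBlock_sq hξ hf hf2 i j] at h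
  have := integral_nonneg (μ := μ) (f := fun ω => (centeredBlock f ξ μ 0 (i + j) ω
    - (centeredBlock f ξ μ 0 i ω + centeredBlock f ξ μ i (i + j) ω)) ^ 2) fun _ => sq_nonneg _
  linarith

/-- Centering by a conditional expectation `E` is an orthogonal projection and removes exactly `∫
E²`. -/
lemma centeredVar_le (n : ℕ) : centeredVar f ξ μ n ≤ ∫ ω, partialSum f ξ n ω ^ 2 ∂μ := by
  have hS := memLp_blockSum hξ hf hf2 0 n
  set E := μ[blockSum f ξ 0 n | pairSigma ξ (0 : ℕ) n] with hE
  have hEL : MemLp E 2 μ := hS.condExp one_le_two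
  have h := integral_mul_condExp_eq (pairSigma_le hξ.measurable (0 : ℕ) n)
    (stronglyMeasurable_condExp : StronglyMeasurable[pairSigma ξ (0 : ℕ) n] E)
    (hEL.integrable_mul hS) (hS.integrable one_le_two)
  have e : ∀ ω, centeredBlock f ξ μ 0 n ω ^ 2
      = partialSum f ξ n ω ^ 2 - 2 * (E ω * blockSum f ξ 0 n ω) + E ω ^ 2 := by
    intro ω
    simp only [centeredBlock, Pi.sub_apply, partialSum_eq_blockSum, ← hE]
    ring
  have h1 : Integrable (fun ω => 2 * (E ω * blockSum f ξ 0 n ω)) μ :=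
    (integrable_mul_of_memLp_two hEL hS).const_mul 2
  have h2 : Integrable (fun ω => partialSum f ξ n ω ^ 2) μ := hS.integrable_sq
  have h3 : Integrable (fun ω => partialSum f ξ n ω ^ 2 - 2 * (E ω * blockSum f ξ 0 n ω)) μ :=
    h2.sub h1
  have h4 : ∫ ω, E ω * E ω ∂μ = ∫ ω, E ω ^ 2 ∂μ := by simp_rw [pow_two]
  rw [← hE, h4] at h
  unfold centeredVar
  simp_rw [e]
  rw [integral_add h3 hEL.integrable_sq, integral_sub h2 h1, integral_const_mul, h]
  have := integral_nonneg (μ := μ) (f := fun ω => E ω ^ 2) fun _ => sq_nonneg _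
  linarith

/-- The `L²` distance between a centered block and the sum of its centered subblocks. -/
lemma integral_centeredBlock_sub_sum_blocks_sq {n m u : ℕ} (h : u * m ≤ n) :
    ∫ ω, (centeredBlock f ξ μ 0 n ω
        - ∑ k ∈ Finset.range u, centeredBlock f ξ μ (k * m) (k * m + m) ω) ^ 2 ∂μ
      = centeredVar f ξ μ n - u * centeredVar f ξ μ m := by
  have hp : Monotone fun k : ℕ => k * m := fun k l hkl => Nat.mul_le_mul_right m hkl
  have := integral_centeredBlock_sub_sum_sq hξ hf hf2 (n := n) hp (u := u) h
  simp only [Nat.succ_mul, integral_centeredBlock_sq hξ hf hf2] at this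
  simpa using this

end Variance

/-- The variance of `|h|` is nonnegative. -/
lemma integral_abs_le_sqrt {α : Type*} [MeasurableSpace α] {μ : Measure α} [IsProbabilityMeasure μ]
    {h : α → ℝ} (hh : MemLp h 2 μ) : ∫ x, |h x| ∂μ ≤ √(∫ x, h x ^ 2 ∂μ) := by
  refine Real.le_sqrt_of_sq_le ?_
  have hi := (hh.integrable one_le_two).abs
  set c := ∫ x, |h x| ∂μ with hc
  have h0 : 0 ≤ ∫ x, (h x ^ 2 - 2 * c * |h x| + c ^ 2) ∂μ := by
    refine integral_nonneg fun x => ?_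
    have : h x ^ 2 - 2 * c * |h x| + c ^ 2 = (|h x| - c) ^ 2 := by rw [← sq_abs (h x)]; ring
    simp only [Pi.zero_apply, this]
    positivity
  have h1 : Integrable (fun x => h x ^ 2 - 2 * c * |h x|) μ :=
    hh.integrable_sq.sub (hi.const_mul _)
  rw [integral_add h1 (integrable_const _), integral_sub hh.integrable_sq (hi.const_mul _),
    integral_const_mul, ← hc] at h0
  simp only [integral_const, probReal_univ, one_smul] at h0
  linarith

/-! ### The mean ergodic theorem. -/

section MeanErgodic

variable {α : Type*} [MeasurableSpace α] {μ : Measure α} {T : α → α}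

lemma integrable_birkhoff (hT : MeasurePreserving T μ μ) {V : α → ℝ} (hV : Integrable V μ)
    (n : ℕ) : Integrable (fun x => (n : ℝ)⁻¹ * ∑ k ∈ Finset.range n, V (T^[k] x)) μ :=
  (integrable_finsetSum _ fun k _ => (hT.iterate k).integrable_comp_of_integrable hV).const_mul _

lemma integral_birkhoff (hT : MeasurePreserving T μ μ) {V : α → ℝ} (hV : Integrable V μ)
    {n : ℕ} (hn : n ≠ 0) :
    ∫ x, (n : ℝ)⁻¹ * ∑ k ∈ Finset.range n, V (T^[k] x) ∂μ = ∫ x, V x ∂μ := by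
  have h : ∀ k, ∫ x, V (T^[k] x) ∂μ = ∫ x, V x ∂μ := by
    intro k
    have hk := hT.iterate k
    conv_rhs => rw [← hk.map_eq]
    rw [integral_map hk.measurable.aemeasurable]
    rw [hk.map_eq]; exact hV.aestronglyMeasurable
  have hi : ∀ k, Integrable (fun x => V (T^[k] x)) μ := fun k =>
    (hT.iterate k).integrable_comp_of_integrable hV
  rw [integral_const_mul, integral_finsetSum _ fun k _ => hi k]
  simp only [h, Finset.sum_const, Finset.card_range, nsmul_eq_mul]
  field_simp

variable [IsProbabilityMeasure μ]

/-- The mean ergodic theorem, for square integrable functions. -/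
lemma tendsto_integral_abs_birkhoff_sub_of_memLp_two (hT : Ergodic T μ) {V : α → ℝ}
    (hV : MemLp V 2 μ) :
    Tendsto (fun n : ℕ => ∫ x, |(n : ℝ)⁻¹ * ∑ k ∈ Finset.range n, V (T^[k] x) - ∫ y, V y ∂μ| ∂μ)
      atTop (𝓝 0) := by
  have hTm := hT.toMeasurePreserving
  have : Fact ((1 : ENNReal) ≤ 2) := ⟨one_le_two⟩
  set U : Lp ℝ 2 μ →L[ℝ] Lp ℝ 2 μ :=
    (Lp.compMeasurePreservingₗᵢ ℝ T hTm).toContinuousLinearMap with hU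
  have hUn : ‖U‖ ≤ 1 := LinearIsometry.norm_toContinuousLinearMap_le _
  set g := hV.toLp V
  have hlim := U.tendsto_birkhoffAverage_orthogonalProjection hUn g
  -- Von Neumann's theorem gives the projection onto the fixed vectors of the Koopman operator. Its
  -- value is an invariant function, hence a constant by ergodicity.
  set P : Lp ℝ 2 μ := ((U.eqLocus (1 : Lp ℝ 2 μ →L[ℝ] Lp ℝ 2 μ)).orthogonalProjectionOnto g :
    Lp ℝ 2 μ) with hP
  have hPfix : U P = P := ((U.eqLocus (1 : Lp ℝ 2 μ →L[ℝ] Lp ℝ 2 μ)).orthogonalProjectionOnto g).2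
  obtain ⟨c, hc⟩ : ∃ c : ℝ, P =ᵐ[μ] fun _ => c := by
    refine hT.quasiErgodic.ae_eq_const_of_ae_eq_comp_ae (Lp.aestronglyMeasurable P) ?_
    have h1 := Lp.coeFn_compMeasurePreserving P hTm
    have h2 : Lp.compMeasurePreserving T hTm P = P := hPfix
    rw [h2] at h1
    exact h1.symm
  have hiter : ∀ k, (U^[k] g : α → ℝ) =ᵐ[μ] fun x => V (T^[k] x) := by
    intro k
    induction k with
    | zero => exact hV.coeFn_toLp
    | succ k ih =>
      rw [Function.iterate_succ_apply']
      refine (Lp.coeFn_compMeasurePreserving (U^[k] g) hTm).trans ?_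
      refine (hTm.quasiMeasurePreserving.ae_eq_comp ih).trans (Eventually.of_forall fun x => ?_)
      simp [Function.iterate_succ_apply]
  have havg : ∀ n : ℕ,
      ((birkhoffAverage ℝ U (id : Lp ℝ 2 μ → Lp ℝ 2 μ) n g : Lp ℝ 2 μ) : α → ℝ) =ᵐ[μ]
      fun x => (n : ℝ)⁻¹ * ∑ k ∈ Finset.range n, V (T^[k] x) := by
    intro n
    have hsum : ∀ n : ℕ, ((∑ k ∈ Finset.range n, U^[k] g : Lp ℝ 2 μ) : α → ℝ) =ᵐ[μ]
        fun x => ∑ k ∈ Finset.range n, V (T^[k] x) := by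
      intro n
      induction n with
      | zero => simpa using! Lp.coeFn_zero ℝ 2 μ
      | succ n ih =>
        simp_rw [Finset.sum_range_succ]
        exact (Lp.coeFn_add _ _).trans (ih.add (hiter n))
    refine (Lp.coeFn_smul _ _).trans ?_
    exact (hsum n).const_smul _
  have hL1 : ∀ n : ℕ, ∫ x, |(n : ℝ)⁻¹ * ∑ k ∈ Finset.range n, V (T^[k] x) - c| ∂μ
      ≤ ‖birkhoffAverage ℝ U (id : Lp ℝ 2 μ → Lp ℝ 2 μ) n g - P‖ := by
    intro n
    set h := birkhoffAverage ℝ U (id : Lp ℝ 2 μ → Lp ℝ 2 μ) n g - P with hh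
    have h1 : (h : α → ℝ) =ᵐ[μ] fun x => (n : ℝ)⁻¹ * ∑ k ∈ Finset.range n, V (T^[k] x) - c :=
      (Lp.coeFn_sub _ _).trans ((havg n).sub hc)
    have h2 : ∫ x, |(n : ℝ)⁻¹ * ∑ k ∈ Finset.range n, V (T^[k] x) - c| ∂μ = ∫ x, |h x| ∂μ := by
      refine integral_congr_ae ?_
      filter_upwards [h1] with x hx
      rw [hx]
    rw [h2]
    refine (integral_abs_le_sqrt (Lp.memLp h)).trans (le_of_eq ?_)
    rw [Real.sqrt_eq_iff_mul_self_eq (integral_nonneg fun _ => sq_nonneg _) (norm_nonneg _),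
      ← real_inner_self_eq_norm_mul_norm, L2.inner_def]
    refine integral_congr_ae (Eventually.of_forall fun x => ?_)
    simp only [real_inner_self_eq_norm_sq, Real.norm_eq_abs, sq_abs]
  have hlim0 : Tendsto (fun n : ℕ => ∫ x, |(n : ℝ)⁻¹ * ∑ k ∈ Finset.range n, V (T^[k] x) - c| ∂μ)
      atTop (𝓝 0) :=
    squeeze_zero (fun n => integral_nonneg fun _ => abs_nonneg _) hL1
      (tendsto_iff_norm_sub_tendsto_zero.1 hlim)
  have hVi := hV.integrable one_le_two
  -- Birkhoff averages preserve the integral, which determines the constant.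
  have hcV : c = ∫ y, V y ∂μ := by
    refine (sub_eq_zero.1 (abs_eq_zero.1 (le_antisymm ?_ (abs_nonneg _)))).symm
    refine ge_of_tendsto hlim0 ?_
    filter_upwards [eventually_ne_atTop 0] with n hn
    rw [← integral_birkhoff hTm hVi hn]
    have : ∫ x, ((n : ℝ)⁻¹ * ∑ k ∈ Finset.range n, V (T^[k] x) - c) ∂μ =
        ∫ x, (n : ℝ)⁻¹ * ∑ k ∈ Finset.range n, V (T^[k] x) ∂μ - c := by
      rw [integral_sub (integrable_birkhoff hTm hVi n) (integrable_const c)]; simp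
    rw [← this]
    exact abs_integral_le_integral_abs
  rw [← hcV]
  exact hlim0

/-- The mean ergodic theorem in `L¹`. -/
lemma tendsto_integral_abs_birkhoff_sub (hT : Ergodic T μ) {V : α → ℝ} (hV : Integrable V μ) :
    Tendsto (fun n : ℕ => ∫ x, |(n : ℝ)⁻¹ * ∑ k ∈ Finset.range n, V (T^[k] x) - ∫ y, V y ∂μ| ∂μ)
      atTop (𝓝 0) := by
  have hTm := hT.toMeasurePreserving
  rw [Metric.tendsto_atTop]
  intro ε hε
  -- Approximation by a simple function: averaging does not increase the `L¹` distance, so the three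
  -- errors below are each less than `ε / 3`. The `L¹` version is needed since conditional variances
  -- are only integrable.
  obtain ⟨W, hW, hWm⟩ : ∃ W : α → ℝ, ∫ x, |V x - W x| ∂μ < ε / 3 ∧ MemLp W 2 μ := by
    obtain ⟨W, hW, hWL⟩ := (memLp_one_iff_integrable.2 hV).exists_simpleFunc_eLpNorm_sub_lt
      ENNReal.one_ne_top (ε := ENNReal.ofReal (ε / 3)) (by simpa using hε)
    refine ⟨W, ?_, W.memLp_of_isFiniteMeasure 2 μ⟩
    have hi : Integrable (V - (W : α → ℝ)) μ := hV.sub (memLp_one_iff_integrable.1 hWL)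
    rw [eLpNorm_one_eq_lintegral_enorm] at hW
    have := integral_norm_eq_lintegral_enorm hi.aestronglyMeasurable
    simp only [Pi.sub_apply, Real.norm_eq_abs] at this
    rw [this]
    exact (ENNReal.toReal_lt_of_lt_ofReal hW)
  have hWi := hWm.integrable one_le_two
  obtain ⟨N, hN⟩ := Metric.tendsto_atTop.1 (tendsto_integral_abs_birkhoff_sub_of_memLp_two hT hWm)
    (ε / 3) (by positivity)
  refine ⟨max N 1, fun n hn => ?_⟩
  have hN := hN n (le_of_max_le_left hn)
  have hn0 : n ≠ 0 := by have := le_of_max_le_right hn; omega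
  rw [Real.dist_0_eq_abs, abs_of_nonneg (integral_nonneg fun _ => abs_nonneg _)] at hN ⊢
  have hD : Integrable (fun x => |V x - W x|) μ := (hV.sub hWi).abs
  have h1 := integral_birkhoff hTm hD hn0
  have h2 : |∫ y, W y ∂μ - ∫ y, V y ∂μ| ≤ ∫ x, |V x - W x| ∂μ := by
    rw [abs_sub_comm, ← integral_sub hV hWi]
    exact abs_integral_le_integral_abs
  have hi1 := integrable_birkhoff hTm hD n
  have hi2 : Integrable (fun x =>
      |(n : ℝ)⁻¹ * ∑ k ∈ Finset.range n, W (T^[k] x) - ∫ y, W y ∂μ|) μ :=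
    ((integrable_birkhoff hTm hWi n).sub (integrable_const _)).abs
  have hle : ∫ x, |(n : ℝ)⁻¹ * ∑ k ∈ Finset.range n, V (T^[k] x) - ∫ y, V y ∂μ| ∂μ
      ≤ ∫ x, ((n : ℝ)⁻¹ * ∑ k ∈ Finset.range n, |V (T^[k] x) - W (T^[k] x)|
        + |(n : ℝ)⁻¹ * ∑ k ∈ Finset.range n, W (T^[k] x) - ∫ y, W y ∂μ|
        + |∫ y, W y ∂μ - ∫ y, V y ∂μ|) ∂μ := by
    refine integral_mono ((integrable_birkhoff hTm hV n).sub (integrable_const _)).abs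
      ((hi1.add hi2).add (integrable_const _)) fun x => ?_
    have h3 : |(n : ℝ)⁻¹ * ∑ k ∈ Finset.range n, V (T^[k] x)
        - (n : ℝ)⁻¹ * ∑ k ∈ Finset.range n, W (T^[k] x)|
        ≤ (n : ℝ)⁻¹ * ∑ k ∈ Finset.range n, |V (T^[k] x) - W (T^[k] x)| := by
      rw [← mul_sub, ← Finset.sum_sub_distrib, abs_mul, abs_of_nonneg (by positivity)]
      gcongr
      exact Finset.abs_sum_le_sum_abs _ _
    refine (abs_sub_le _ ((n : ℝ)⁻¹ * ∑ k ∈ Finset.range n, W (T^[k] x)) _).trans ?_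
    rw [add_assoc]
    exact add_le_add h3 (abs_sub_le _ _ _)
  have hi12 : Integrable (fun x => (n : ℝ)⁻¹ * ∑ k ∈ Finset.range n, |V (T^[k] x) - W (T^[k] x)|
      + |(n : ℝ)⁻¹ * ∑ k ∈ Finset.range n, W (T^[k] x) - ∫ y, W y ∂μ|) μ := hi1.add hi2
  rw [integral_add hi12 (integrable_const _), integral_add hi1 hi2, h1] at hle
  simp only [integral_const, probReal_univ, one_smul] at hle
  linarith

end MeanErgodic

/-! ### Bounds for exponential remainders. -/

section Taylor

/-- The remainder of order two of the exponential function on the imaginary axis. -/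
noncomputable def expRemainder (x : ℝ) : ℂ :=
  Complex.exp (x * Complex.I) - 1 - x * Complex.I + x ^ 2 / 2

/-- Taylor's bound for `|x| ≤ 1`, the triangle inequality beyond. With second moments only, the
quadratic bound serves as dominating function and the cubic one gives the pointwise limit; `4` is
merely convenient. -/
lemma norm_expRemainder_le (x : ℝ) :
    ‖expRemainder x‖ ≤ 4 * x ^ 2 ∧ ‖expRemainder x‖ ≤ 4 * |x| ^ 3 := by
  have h2 : x ^ 2 = |x| ^ 2 := (sq_abs x).symm
  have hx0 := abs_nonneg x
  rcases le_total |x| 1 with hx | hx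
  · have h := Complex.exp_bound (x := x * Complex.I) (by simpa using hx) (n := 3) (by norm_num)
    have e : Complex.exp (x * Complex.I) - ∑ m ∈ Finset.range 3, (x * Complex.I) ^ m / m.factorial
        = expRemainder x := by
      simp only [expRemainder, Finset.sum_range_succ, Finset.sum_range_zero, mul_pow, Complex.I_sq]
      norm_num [Nat.factorial]
      ring
    rw [e] at h
    have h3 : ‖expRemainder x‖ ≤ |x| ^ 3 := by
      refine h.trans ?_
      have : ‖(x : ℂ) * Complex.I‖ = |x| := by simp
      rw [this]
      refine mul_le_of_le_one_right (by positivity) ?_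
      norm_num [Nat.factorial]
    have h4 : |x| ^ 3 ≤ |x| ^ 2 := pow_le_pow_of_le_one hx0 hx (by norm_num)
    constructor
    · rw [h2]; nlinarith [sq_nonneg |x|]
    · nlinarith [pow_nonneg hx0 3]
  · have h : ‖expRemainder x‖ ≤ 1 + 1 + |x| + |x| ^ 2 / 2 := by
      unfold expRemainder
      refine (norm_add_le _ _).trans (add_le_add ((norm_sub_le _ _).trans
        (add_le_add ((norm_sub_le _ _).trans (add_le_add ?_ ?_)) ?_)) ?_)
      · rw [Complex.norm_exp_ofReal_mul_I]
      · simp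
      · simp
      · simp
    have h5 : ‖expRemainder x‖ ≤ 4 * |x| ^ 2 := by nlinarith
    refine ⟨h2 ▸ h5, h5.trans ?_⟩
    have := pow_le_pow_right₀ hx (show 2 ≤ 3 by norm_num)
    linarith

lemma continuous_expRemainder : Continuous expRemainder := by
  unfold expRemainder
  fun_prop

/-- The linear bound is for domination, the quadratic one for the pointwise limit. -/
lemma exp_neg_sub_one_add_bounds {y : ℝ} (hy : 0 ≤ y) :
    0 ≤ Real.exp (-y) - 1 + y ∧ Real.exp (-y) - 1 + y ≤ y ∧ Real.exp (-y) - 1 + y ≤ y ^ 2 := by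
  have h1 := Real.add_one_le_exp (-y)
  have h2 : Real.exp (-y) ≤ 1 := Real.exp_le_one_iff.2 (by linarith)
  refine ⟨by linarith, by linarith, ?_⟩
  rcases le_total y 1 with h | h
  · have := Real.abs_exp_sub_one_sub_id_le (x := -y) (by rwa [abs_neg, abs_of_nonneg hy])
    have := le_of_abs_le this
    rw [neg_sq] at this
    linarith
  · nlinarith

lemma abs_exp_neg_sub_exp_neg_le {x y : ℝ} (hx : 0 ≤ x) (hy : 0 ≤ y) :
    |Real.exp (-x) - Real.exp (-y)| ≤ |x - y| := by
  wlog h : x ≤ y generalizing x y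
  · rw [abs_sub_comm, abs_sub_comm x]
    exact this hy hx (le_of_not_ge h)
  have h1 : Real.exp (-y) ≤ Real.exp (-x) := Real.exp_le_exp.2 (by linarith)
  rw [abs_of_nonneg (by linarith), abs_of_nonpos (by linarith)]
  have h2 := Real.add_one_le_exp (-(y - x))
  have h3 : Real.exp (-y) = Real.exp (-x) * Real.exp (-(y - x)) := by
    rw [← Real.exp_add]; congr 1; ring
  have h4 : Real.exp (-x) ≤ 1 := Real.exp_le_one_iff.2 (by linarith)
  nlinarith [Real.exp_pos (-x)]

end Taylor

/-! ### Lindeberg replacement with conditional variances. -/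

section ConditionalCLT

lemma integral_smul_eq_zero_of_condExp_eq_zero {Ω : Type*} {m m₀ : MeasurableSpace Ω}
    {μ : Measure Ω} [IsProbabilityMeasure μ] (hm : m ≤ m₀) {W : Ω → ℝ} (hW : Integrable W μ)
    (hW0 : μ[W | m] =ᵐ[μ] 0) {G : Ω → ℂ} (hG : StronglyMeasurable[m] G) (hG1 : ∀ ω, ‖G ω‖ ≤ 1) :
    ∫ ω, W ω • G ω ∂μ = 0 := by
  have hi : Integrable (W • G) μ :=
    hW.smul_bdd 1 (hG.mono hm).aestronglyMeasurable (Eventually.of_forall hG1)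
  rw [← integral_condExp hm (f := fun ω => W ω • G ω)]
  have h := condExp_smul_of_aestronglyMeasurable_right hW hi hG.aestronglyMeasurable
  rw [integral_congr_ae (g := 0)]
  · simp
  · refine EventuallyEq.trans h ?_
    filter_upwards [hW0] with ω hω
    simp [hω]

variable {Ω : Type*} [MeasurableSpace Ω] {μ : Measure Ω}

/-- Dominated convergence: the integrand is at most `4 t² D²` and pointwise of order `1 / √u`. The
total error of `u` replacements is thus negligible. -/
lemma tendsto_mul_integral_expRemainder {D : Ω → ℝ} (hD : MemLp D 2 μ) (t : ℝ) :
    Tendsto (fun u : ℕ => (u : ℝ) * ∫ ω, ‖expRemainder (t / √u * D ω)‖ ∂μ) atTop (𝓝 0) := by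
  simp_rw [← integral_const_mul]
  rw [← integral_zero Ω ℝ (μ := μ)]
  refine tendsto_integral_of_dominated_convergence (fun ω => 4 * (t ^ 2 * D ω ^ 2)) ?_
    ((hD.integrable_sq.const_mul _).const_mul _) ?_ ?_
  · intro u
    exact ((continuous_expRemainder.comp_aestronglyMeasurable
      (hD.aestronglyMeasurable.const_mul _)).norm).const_mul _
  · intro u
    refine Eventually.of_forall fun ω => ?_
    rw [Real.norm_of_nonneg (by positivity)]
    have h := (norm_expRemainder_le (t / √u * D ω)).1
    calc (u : ℝ) * ‖expRemainder (t / √u * D ω)‖ ≤ u * (4 * (t / √u * D ω) ^ 2) := by gcongr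
      _ = (u / √u ^ 2) * (4 * (t ^ 2 * D ω ^ 2)) := by ring
      -- An inequality, because the quotient is `0` when `u = 0`.
      _ ≤ 1 * (4 * (t ^ 2 * D ω ^ 2)) := by
        gcongr
        rw [Real.sq_sqrt (Nat.cast_nonneg u)]
        exact div_self_le_one _
      _ = _ := one_mul _
  · refine Eventually.of_forall fun ω => ?_
    have hlim : Tendsto (fun u : ℕ => 4 * |t * D ω| ^ 3 / √(u : ℝ)) atTop (𝓝 0) :=
      tendsto_const_nhds.div_atTop (Real.tendsto_sqrt_atTop.comp tendsto_natCast_atTop_atTop)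
    refine squeeze_zero' (Eventually.of_forall fun u => by positivity) ?_ hlim
    filter_upwards [eventually_gt_atTop 0] with u hu
    have hu' : (0 : ℝ) < √u := Real.sqrt_pos.2 (by exact_mod_cast hu)
    have h := (norm_expRemainder_le (t / √u * D ω)).2
    calc (u : ℝ) * ‖expRemainder (t / √u * D ω)‖ ≤ u * (4 * |t / √u * D ω| ^ 3) := by gcongr
      _ = √u ^ 2 * (4 * |t / √u * D ω| ^ 3) := by rw [Real.sq_sqrt (Nat.cast_nonneg u)]
      _ = 4 * |t * D ω| ^ 3 / √u := by
        rw [div_mul_eq_mul_div, abs_div, abs_of_pos hu']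
        field_simp

lemma tendsto_mul_integral_exp_neg_remainder {V : Ω → ℝ} (hV : Integrable V μ)
    (hV0 : ∀ ω, 0 ≤ V ω) (t : ℝ) :
    Tendsto (fun u : ℕ => (u : ℝ) * ∫ ω, (Real.exp (-((t / √u) ^ 2 * V ω / 2)) - 1
      + (t / √u) ^ 2 * V ω / 2) ∂μ) atTop (𝓝 0) := by
  simp_rw [← integral_const_mul]
  rw [← integral_zero Ω ℝ (μ := μ)]
  have hy : ∀ (u : ℕ) ω, 0 ≤ (t / √u) ^ 2 * V ω / 2 := fun u ω => by
    have := hV0 ω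
    positivity
  refine tendsto_integral_of_dominated_convergence (fun ω => t ^ 2 * V ω / 2) ?_
    ((hV.const_mul _).div_const _) ?_ ?_
  · intro u
    have := hV.aestronglyMeasurable
    fun_prop
  · intro u
    refine Eventually.of_forall fun ω => ?_
    obtain ⟨h0, h1, -⟩ := exp_neg_sub_one_add_bounds (hy u ω)
    rw [Real.norm_of_nonneg (by positivity)]
    have hV' := hV0 ω
    calc _ ≤ (u : ℝ) * ((t / √u) ^ 2 * V ω / 2) := by gcongr
      _ = (u / √u ^ 2) * (t ^ 2 * V ω / 2) := by ring
      _ ≤ 1 * (t ^ 2 * V ω / 2) := by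
        gcongr
        rw [Real.sq_sqrt (Nat.cast_nonneg u)]
        exact div_self_le_one _
      _ = _ := one_mul _
  · refine Eventually.of_forall fun ω => ?_
    have hlim : Tendsto (fun u : ℕ => (t ^ 2 * V ω / 2) ^ 2 / (u : ℝ)) atTop (𝓝 0) :=
      tendsto_const_nhds.div_atTop tendsto_natCast_atTop_atTop
    refine squeeze_zero' (Eventually.of_forall fun u => ?_) ?_ hlim
    · exact mul_nonneg (Nat.cast_nonneg u) (exp_neg_sub_one_add_bounds (hy u ω)).1
    filter_upwards [eventually_gt_atTop 0] with u hu
    have hu' : (0 : ℝ) < u := by exact_mod_cast hu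
    have h := (exp_neg_sub_one_add_bounds (hy u ω)).2.2
    calc _ ≤ (u : ℝ) * ((t / √u) ^ 2 * V ω / 2) ^ 2 := by gcongr
      _ = (t ^ 2 * V ω / 2) ^ 2 / u := by
        rw [div_pow t, Real.sq_sqrt hu'.le]
        field_simp

/-- One step of Lindeberg's replacement scheme: `exp(isD)` is replaced by `exp(-s²V/2)`. -/
lemma norm_integral_replace_le {Ω : Type*} {m m₀ : MeasurableSpace Ω} {μ : Measure Ω}
    [IsProbabilityMeasure μ] (hm : m ≤ m₀) {D V : Ω → ℝ} (hD : MemLp D 2 μ) (hV : Integrable V μ)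
    (hV0 : ∀ ω, 0 ≤ V ω) (hDm : μ[D | m] =ᵐ[μ] 0) (hDV : μ[fun ω => D ω ^ 2 - V ω | m] =ᵐ[μ] 0)
    {G : Ω → ℂ} (hG : StronglyMeasurable[m] G) (hG1 : ∀ ω, ‖G ω‖ ≤ 1) (s : ℝ) :
    ‖∫ ω, G ω * (Complex.exp (((s * D ω : ℝ) : ℂ) * Complex.I)
        - (Real.exp (-(s ^ 2 * V ω / 2)) : ℝ)) ∂μ‖
      ≤ ∫ ω, ‖expRemainder (s * D ω)‖ ∂μ
        + ∫ ω, (Real.exp (-(s ^ 2 * V ω / 2)) - 1 + s ^ 2 * V ω / 2) ∂μ := by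
  set ρ : Ω → ℝ := fun ω => Real.exp (-(s ^ 2 * V ω / 2)) - 1 + s ^ 2 * V ω / 2 with hρ
  have hρ0 : ∀ ω, 0 ≤ ρ ω ∧ ρ ω ≤ s ^ 2 * V ω / 2 := fun ω => by
    have := exp_neg_sub_one_add_bounds (y := s ^ 2 * V ω / 2) (by have := hV0 ω; positivity)
    exact ⟨this.1, this.2.1⟩
  have hGa : AEStronglyMeasurable G μ := (hG.mono hm).aestronglyMeasurable
  have hDi := hD.integrable one_le_two
  have hWi : Integrable (fun ω => D ω ^ 2 - V ω) μ := hD.integrable_sq.sub hV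
  have hVa := hV.aestronglyMeasurable
  have hri : Integrable (fun ω => expRemainder (s * D ω)) μ := by
    refine (((hD.integrable_sq.const_mul (s ^ 2)).const_mul 4)).mono'
      (continuous_expRemainder.comp_aestronglyMeasurable
        (hD.aestronglyMeasurable.const_mul _)) (Eventually.of_forall fun ω => ?_)
    rw [← mul_pow]
    exact (norm_expRemainder_le _).1
  have hρi : Integrable ρ μ := by
    refine ((hV.const_mul (s ^ 2)).div_const 2).mono' (by fun_prop)
      (Eventually.of_forall fun ω => ?_)
    rw [Real.norm_of_nonneg (hρ0 ω).1]
    exact (hρ0 ω).2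
  have h1 : Integrable (fun ω => D ω • G ω) μ := hDi.smul_bdd 1 hGa (Eventually.of_forall hG1)
  have h2 : Integrable (fun ω => (D ω ^ 2 - V ω) • G ω) μ :=
    hWi.smul_bdd 1 hGa (Eventually.of_forall hG1)
  have h3 : Integrable (fun ω => G ω * expRemainder (s * D ω)) μ :=
    hri.bdd_mul hGa (Eventually.of_forall hG1)
  have h4 : Integrable (fun ω => ρ ω • G ω) μ := hρi.smul_bdd 1 hGa (Eventually.of_forall hG1)
  -- Both exponentials are expanded to second order in `s`; the constants cancel. The terms in `D`
  -- and in `D² - V` integrate to zero against `G`, leaving the two remainders.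
  have e : ∀ ω, G ω * (Complex.exp (((s * D ω : ℝ) : ℂ) * Complex.I)
        - (Real.exp (-(s ^ 2 * V ω / 2)) : ℝ))
      = (s * Complex.I) * (D ω • G ω) - (s ^ 2 / 2 : ℂ) * ((D ω ^ 2 - V ω) • G ω)
        + (G ω * expRemainder (s * D ω) - ρ ω • G ω) := by
    intro ω
    simp only [hρ, expRemainder, Complex.real_smul]
    push_cast
    ring
  simp_rw [e]
  have h12 : Integrable (fun ω => (s * Complex.I) * (D ω • G ω)
      - (s ^ 2 / 2 : ℂ) * ((D ω ^ 2 - V ω) • G ω)) μ := (h1.const_mul _).sub (h2.const_mul _)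
  have h34 : Integrable (fun ω => G ω * expRemainder (s * D ω) - ρ ω • G ω) μ := h3.sub h4
  rw [integral_add h12 h34, integral_sub (h1.const_mul _) (h2.const_mul _), integral_const_mul,
    integral_const_mul, integral_smul_eq_zero_of_condExp_eq_zero hm hDi hDm hG hG1,
    integral_smul_eq_zero_of_condExp_eq_zero hm hWi hDV hG hG1, mul_zero, mul_zero, sub_zero,
    zero_add, integral_sub h3 h4]
  refine (norm_sub_le _ _).trans (add_le_add ?_ ?_)
  · refine norm_integral_le_of_norm_le hri.norm (Eventually.of_forall fun ω => ?_)
    rw [norm_mul]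
    exact mul_le_of_le_one_left (norm_nonneg _) (hG1 ω)
  · refine norm_integral_le_of_norm_le hρi (Eventually.of_forall fun ω => ?_)
    rw [norm_smul, Real.norm_of_nonneg (hρ0 ω).1]
    exact mul_le_of_le_one_right (hρ0 ω).1 (hG1 ω)

/-- A central limit theorem for identically distributed variables that are centered given the
preceding variables and all the following conditional variances. -/
lemma tendsto_integral_exp_sum_of_condExp [IsProbabilityMeasure μ]
    {O : ℕ → ℕ → MeasurableSpace Ω} {D V : ℕ → Ω → ℝ}
    (hO : ∀ u k, O u k ≤ ‹MeasurableSpace Ω›)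
    (hDO : ∀ {u j k}, j < k → k < u → StronglyMeasurable[O u k] (D j))
    (hVO : ∀ {u j k}, k < j → j < u → StronglyMeasurable[O u k] (V j))
    (hD0 : ∀ {u k}, k < u → μ[D k | O u k] =ᵐ[μ] 0)
    (hV0 : ∀ {u k}, k < u → μ[fun ω => D k ω ^ 2 - V k ω | O u k] =ᵐ[μ] 0)
    (hDi : ∀ k, IdentDistrib (D k) (D 0) μ μ) (hVi : ∀ k, IdentDistrib (V k) (V 0) μ μ)
    (hD : MemLp (D 0) 2 μ) (hV : Integrable (V 0) μ) (hVnn : ∀ k ω, 0 ≤ V k ω) {c : ℝ} (hc : 0 ≤ c)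
    (hlln : Tendsto (fun u : ℕ => ∫ ω, |(u : ℝ)⁻¹ * ∑ k ∈ Finset.range u, V k ω - c| ∂μ)
      atTop (𝓝 0)) (t : ℝ) :
    Tendsto (fun u : ℕ => ∫ ω, Complex.exp
        (((t / √u * ∑ k ∈ Finset.range u, D k ω : ℝ) : ℂ) * Complex.I) ∂μ)
      atTop (𝓝 ((Real.exp (-(t ^ 2 * c / 2)) : ℝ) : ℂ)) := by
  have hDL : ∀ k, MemLp (D k) 2 μ := fun k => (hDi k).symm.memLp_snd hD
  have hVL : ∀ k, Integrable (V k) μ := fun k => (hVi k).symm.integrable_snd hV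
  let e : ℝ → ℕ → Ω → ℂ := fun s k ω => Complex.exp (((s * D k ω : ℝ) : ℂ) * Complex.I)
  let a : ℝ → ℕ → Ω → ℂ := fun s k ω => ((Real.exp (-(s ^ 2 * V k ω / 2)) : ℝ) : ℂ)
  let δ : ℝ → ℝ := fun s => ∫ ω, ‖expRemainder (s * D 0 ω)‖ ∂μ
        + ∫ ω, (Real.exp (-(s ^ 2 * V 0 ω / 2)) - 1 + s ^ 2 * V 0 ω / 2) ∂μ
  have he1 : ∀ s k ω, ‖e s k ω‖ ≤ 1 := fun s k ω => (Complex.norm_exp_ofReal_mul_I _).le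
  have ha1 : ∀ s k ω, ‖a s k ω‖ ≤ 1 := fun s k ω => by
    simp only [a, Complex.norm_real, Real.norm_eq_abs, Real.abs_exp]
    refine Real.exp_le_one_iff.2 ?_
    have := hVnn k ω
    have : 0 ≤ s ^ 2 * V k ω / 2 := by positivity
    linarith
  have hem : ∀ {m : MeasurableSpace Ω} s k, StronglyMeasurable[m] (D k) →
      StronglyMeasurable[m] (e s k) := fun s k h =>
    (by fun_prop : Continuous fun x : ℝ => Complex.exp (((s * x : ℝ) : ℂ) * Complex.I))
      |>.comp_stronglyMeasurable h
  have ham : ∀ {m : MeasurableSpace Ω} s k, StronglyMeasurable[m] (V k) →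
      StronglyMeasurable[m] (a s k) := fun s k h =>
    (by fun_prop : Continuous fun x : ℝ => ((Real.exp (-(s ^ 2 * x / 2)) : ℝ) : ℂ))
      |>.comp_stronglyMeasurable h
  -- Hybrid products: the first `k` factors are the original ones, the others already replaced.
  -- Passing from `k` to `k + 1` changes factor `k` only, and all other factors are measurable for
  -- `O u k`.
  let P : ℝ → ℕ → ℕ → Ω → ℂ := fun s u k ω =>
    (∏ j ∈ Finset.range k, e s j ω) * ∏ j ∈ Finset.Ico k u, a s j ω
  have hPi : ∀ s u k, Integrable (P s u k) μ := by
    intro s u k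
    have hm : AEStronglyMeasurable (P s u k) μ := by
      refine (Finset.aestronglyMeasurable_fun_prod _ fun j _ => ?_).mul
        (Finset.aestronglyMeasurable_fun_prod _ fun j _ => ?_)
      · exact (by fun_prop : Continuous fun x : ℝ => Complex.exp (((s * x : ℝ) : ℂ) * Complex.I))
          |>.comp_aestronglyMeasurable (hDL j).aestronglyMeasurable
      · exact (by fun_prop : Continuous fun x : ℝ => ((Real.exp (-(s ^ 2 * x / 2)) : ℝ) : ℂ))
          |>.comp_aestronglyMeasurable (hVL j).aestronglyMeasurable
    refine (integrable_const (1 : ℝ)).mono' hm (Eventually.of_forall fun ω => ?_)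
    rw [norm_mul, norm_prod, norm_prod]
    exact mul_le_one₀ (Finset.prod_le_one (fun _ _ => norm_nonneg _) fun j _ => he1 s j ω)
      (Finset.prod_nonneg fun _ _ => norm_nonneg _)
      (Finset.prod_le_one (fun _ _ => norm_nonneg _) fun j _ => ha1 s j ω)
  have hstep : ∀ s u k, k < u → ‖∫ ω, P s u (k + 1) ω ∂μ - ∫ ω, P s u k ω ∂μ‖ ≤ δ s := by
    intro s u k hk
    set G : Ω → ℂ := fun ω => (∏ j ∈ Finset.range k, e s j ω) * ∏ j ∈ Finset.Ico (k + 1) u, a s j ω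
    have hG1 : ∀ ω, ‖G ω‖ ≤ 1 := fun ω => by
      rw [norm_mul, norm_prod, norm_prod]
      exact mul_le_one₀ (Finset.prod_le_one (fun _ _ => norm_nonneg _) fun j _ => he1 s j ω)
        (Finset.prod_nonneg fun _ _ => norm_nonneg _)
        (Finset.prod_le_one (fun _ _ => norm_nonneg _) fun j _ => ha1 s j ω)
    have hGm : StronglyMeasurable[O u k] G := by
      refine @StronglyMeasurable.mul _ _ _ (_) _ _ _ _ ?_ ?_
      · exact Finset.stronglyMeasurable_fun_prod _ fun j hj =>
          hem s j (hDO (Finset.mem_range.1 hj) hk)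
      · refine Finset.stronglyMeasurable_fun_prod _ fun j hj => ?_
        rw [Finset.mem_Ico] at hj
        exact ham s j (hVO hj.1 hj.2)
    rw [← integral_sub (hPi s u (k + 1)) (hPi s u k)]
    have e1 : ∀ ω, P s u (k + 1) ω - P s u k ω = G ω * (e s k ω - a s k ω) := by
      intro ω
      simp only [P, G]
      rw [Finset.prod_range_succ, Finset.prod_eq_prod_Ico_succ_bot hk]
      ring
    simp_rw [e1]
    refine (norm_integral_replace_le (hO u k) (hDL k) (hVL k) (hVnn k) (hD0 hk) (hV0 hk) hGm hG1
      s).trans (le_of_eq ?_)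
    -- Identical distribution makes the error of one replacement independent of `k`.
    have i1 := ((hDi k).comp (u := fun x : ℝ => ‖expRemainder (s * x)‖)
      (by have := continuous_expRemainder; fun_prop)).integral_eq
    have i2 := ((hVi k).comp (u := fun x : ℝ => Real.exp (-(s ^ 2 * x / 2)) - 1 + s ^ 2 * x / 2)
      (by fun_prop)).integral_eq
    simp only [Function.comp_def] at i1 i2
    rw [i1, i2]
  have htel : ∀ s u k, k ≤ u → ‖∫ ω, P s u k ω ∂μ - ∫ ω, P s u 0 ω ∂μ‖ ≤ k * δ s := by
    intro s u k
    induction k with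
    | zero => simp
    | succ k ih =>
      intro hk
      have h1 := hstep s u k hk
      have h2 := ih (by omega)
      have h3 := norm_sub_le_norm_sub_add_norm_sub (∫ ω, P s u (k + 1) ω ∂μ) (∫ ω, P s u k ω ∂μ)
        (∫ ω, P s u 0 ω ∂μ)
      push_cast
      linarith
  have hend : ∀ s u, ∫ ω, P s u u ω ∂μ = ∫ ω, Complex.exp
      (((s * ∑ k ∈ Finset.range u, D k ω : ℝ) : ℂ) * Complex.I) ∂μ := by
    intro s u
    refine integral_congr_ae (Eventually.of_forall fun ω => ?_)
    simp only [P, Finset.Ico_self, Finset.prod_empty, mul_one, e, ← Complex.exp_sum]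
    congr 1
    rw [Finset.mul_sum]
    push_cast
    rw [Finset.sum_mul]
  -- With every factor replaced, only the average of the `V k` enters, through an exponential that
  -- is 1-Lipschitz on the half-line.
  have hstart : ∀ u : ℕ, ‖∫ ω, P (t / √u) u 0 ω ∂μ - ((Real.exp (-(t ^ 2 * c / 2)) : ℝ) : ℂ)‖
      ≤ t ^ 2 / 2 * ∫ ω, |(u : ℝ)⁻¹ * ∑ k ∈ Finset.range u, V k ω - c| ∂μ := by
    intro u
    have e1 : ∀ ω, P (t / √u) u 0 ω
        = ((Real.exp (-(t ^ 2 / 2 * ((u : ℝ)⁻¹ * ∑ k ∈ Finset.range u, V k ω))) : ℝ) : ℂ) := by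
      intro ω
      simp only [P, Finset.range_zero, Finset.prod_empty, one_mul, a]
      rw [← Complex.ofReal_prod, ← Real.exp_sum, Nat.Ico_zero_eq_range]
      congr 2
      rw [Finset.mul_sum, Finset.mul_sum, ← Finset.sum_neg_distrib]
      refine Finset.sum_congr rfl fun k _ => ?_
      rw [div_pow, Real.sq_sqrt (Nat.cast_nonneg u)]
      ring
    have hi := hPi (t / √u) u 0
    have e2 : ((Real.exp (-(t ^ 2 * c / 2)) : ℝ) : ℂ)
        = ∫ _, ((Real.exp (-(t ^ 2 * c / 2)) : ℝ) : ℂ) ∂μ := by simp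
    rw [e2, ← integral_sub hi (integrable_const _), ← integral_const_mul]
    refine norm_integral_le_of_norm_le ?_ (Eventually.of_forall fun ω => ?_)
    · exact ((((integrable_finsetSum _ fun k _ => hVL k).const_mul _).sub
        (integrable_const c)).abs).const_mul _
    · rw [e1, ← Complex.ofReal_sub, Complex.norm_real, Real.norm_eq_abs]
      have hs : 0 ≤ (u : ℝ)⁻¹ * ∑ k ∈ Finset.range u, V k ω :=
        mul_nonneg (by positivity) (Finset.sum_nonneg fun k _ => hVnn k ω)
      refine (abs_exp_neg_sub_exp_neg_le (by positivity) (by positivity)).trans (le_of_eq ?_)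
      have : t ^ 2 / 2 * ((u : ℝ)⁻¹ * ∑ k ∈ Finset.range u, V k ω) - t ^ 2 * c / 2
          = t ^ 2 / 2 * ((u : ℝ)⁻¹ * ∑ k ∈ Finset.range u, V k ω - c) := by ring
      rw [this, abs_mul, abs_of_nonneg (by positivity)]
  rw [tendsto_iff_norm_sub_tendsto_zero]
  have hlim : Tendsto (fun u : ℕ => (u : ℝ) * δ (t / √u)
      + t ^ 2 / 2 * ∫ ω, |(u : ℝ)⁻¹ * ∑ k ∈ Finset.range u, V k ω - c| ∂μ) atTop (𝓝 0) := by
    have h1 := (tendsto_mul_integral_expRemainder hD t).add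
      (tendsto_mul_integral_exp_neg_remainder hV (hVnn 0) t)
    have h2 := hlln.const_mul (t ^ 2 / 2)
    simp only [← mul_add, add_zero, mul_zero] at h1 h2
    simpa using h1.add h2
  refine squeeze_zero (fun _ => norm_nonneg _) (fun u => ?_) hlim
  rw [← hend]
  refine (norm_sub_le_norm_sub_add_norm_sub _ (∫ ω, P (t / √u) u 0 ω ∂μ) _).trans
    (add_le_add (htel _ u u le_rfl) (hstart u))

end ConditionalCLT

/-! ### The central limit theorem for blocks of fixed length. -/

section BlockCLT

variable {Ω S : Type*} [MeasurableSpace Ω] [MeasurableSpace S]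
  {f : S → ℝ} {ξ : ℤ → Ω → S} {μ : Measure Ω}

lemma IsStationaryMarkovChain.identDistrib_pathFrom (hξ : IsStationaryMarkovChain ξ μ) (k : ℕ) :
    IdentDistrib (pathFrom ξ k) (pathFrom ξ 0) μ μ where
  aemeasurable_fst := (hξ.measurePreserving_pathFrom k).measurable.aemeasurable
  aemeasurable_snd := (hξ.measurePreserving_pathFrom 0).measurable.aemeasurable
  map_eq := (hξ.measurePreserving_pathFrom k).map_eq.trans
    (hξ.measurePreserving_pathFrom 0).map_eq.symm

variable [IsProbabilityMeasure μ]

/-- The `L¹` law of large numbers along the multiples of `m`. -/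
lemma IsTotallyErgodic.tendsto_integral_abs_average_sub (hξ : IsStationaryMarkovChain ξ μ)
    (herg : IsTotallyErgodic ξ μ) {m : ℕ} (hm : 1 ≤ m) {V : (ℤ → S) → ℝ} (hV : StronglyMeasurable V)
    (hVi : Integrable V (processLaw ξ μ)) :
    Tendsto (fun u : ℕ => ∫ ω, |(u : ℝ)⁻¹ * ∑ k ∈ Finset.range u, V (pathFrom ξ (k * m) ω)
      - ∫ x, V x ∂processLaw ξ μ| ∂μ) atTop (𝓝 0) := by
  have := hξ.isProbabilityMeasure_processLaw
  -- Blocks of length `m` are sampled along the `m`-th power of the shift, whence total ergodicity.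
  refine (tendsto_integral_abs_birkhoff_sub (herg m hm) hVi).congr fun u => ?_
  have hshift : ∀ n : ℕ, Measurable (seqShift^[n] : (ℤ → S) → ℤ → S) := fun n =>
    measurable_seqShift.iterate n
  have hm : StronglyMeasurable fun x : ℤ → S => |(u : ℝ)⁻¹ * ∑ k ∈ Finset.range u,
      V ((seqShift^[m])^[k] x) - ∫ x, V x ∂processLaw ξ μ| := by
    have hs : StronglyMeasurable fun x : ℤ → S =>
        ∑ k ∈ Finset.range u, V ((seqShift^[m])^[k] x) :=
      Finset.stronglyMeasurable_fun_sum _ fun k _ => hV.comp_measurable ((hshift m).iterate k)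
    exact continuous_abs.comp_stronglyMeasurable ((hs.const_mul _).sub stronglyMeasurable_const)
  rw [← hξ.integral_pathFrom 0 hm]
  refine integral_congr_ae (Eventually.of_forall fun ω => ?_)
  have : ∀ k : ℕ, (seqShift^[m])^[k] (pathFrom ξ 0 ω) = pathFrom ξ (k * m) ω := by
    intro k
    rw [← Function.iterate_mul, seqShift_iterate]
    ext j
    simp [pathFrom, mul_comm]
  simp only [this]

/-- The central limit theorem for the sums of the centered blocks of a fixed length. -/
lemma tendsto_integral_exp_sum_centeredBlock (hξ : IsStationaryMarkovChain ξ μ)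
    (herg : IsTotallyErgodic ξ μ) (hf : Measurable f) (hf2 : MemLp f 2 (μ.map (ξ 0)))
    {m : ℕ} (hm : 1 ≤ m) (t : ℝ) :
    Tendsto (fun u : ℕ => ∫ ω, Complex.exp (((t / √u * ∑ k ∈ Finset.range u,
        centeredBlock f ξ μ (k * m) (k * m + m) ω : ℝ) : ℂ) * Complex.I) ∂μ)
      atTop (𝓝 ((Real.exp (-(t ^ 2 * centeredVar f ξ μ m / 2)) : ℝ) : ℂ)) := by
  have hL := memLp_centeredBlock hξ hf hf2
  obtain ⟨D, hD, hDL, hDk⟩ := exists_centeredBlock_eq_pathFrom hξ hf hf2 m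
  have hD2 : StronglyMeasurable fun x => D x ^ 2 := hD.pow 2
  obtain ⟨g, hg, hgk⟩ := hξ.exists_condExp_pathFrom m hD2 hDL.integrable_sq
  -- Truncating at `0` gives a version of the conditional variance that is nonnegative everywhere
  -- and still a fixed function of the endpoint states.
  have hgk' : ∀ k : ℕ, μ[fun ω => centeredBlock f ξ μ k (k + m) ω ^ 2 | pairSigma ξ k (k + m)]
      =ᵐ[μ] fun ω => max (g (ξ k ω, ξ (k + m) ω)) 0 := by
    intro k
    have h1 : (fun ω => centeredBlock f ξ μ k (k + m) ω ^ 2) =ᵐ[μ]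
        fun ω => D (pathFrom ξ k ω) ^ 2 := by
      filter_upwards [hDk k] with ω hω
      rw [hω]
    have h2 : 0 ≤ᵐ[μ] μ[fun ω => D (pathFrom ξ k ω) ^ 2 | pairSigma ξ k (k + m)] :=
      condExp_nonneg (Eventually.of_forall fun ω => sq_nonneg _)
    filter_upwards [condExp_congr_ae (m := pairSigma ξ k (k + m)) h1, hgk k, h2] with ω h3 h4 h5
    rw [h3, h4, max_eq_left]
    rw [h4] at h5
    exact h5
  set v : (ℤ → S) → ℝ := fun x => max (g (x 0, x m)) 0 with hv
  have hvm : StronglyMeasurable v :=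
    (hg.comp_measurable ((measurable_pi_apply _).prodMk (measurable_pi_apply _))).sup
      stronglyMeasurable_const
  have hvk : ∀ (k : ℕ) ω, v (pathFrom ξ k ω) = max (g (ξ k ω, ξ (k + m) ω)) 0 := by
    intro k ω
    simp [hv, pathFrom, add_comm]
  have hvi : ∀ k : ℕ, Integrable (fun ω => v (pathFrom ξ k ω)) μ := by
    intro k
    refine (integrable_condExp (μ := μ) (m := pairSigma ξ k (k + m))
      (f := fun ω => centeredBlock f ξ μ k (k + m) ω ^ 2)).congr ?_
    filter_upwards [hgk' k] with ω hω
    rw [hω, hvk]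
  have hvint : ∫ x, v x ∂processLaw ξ μ = centeredVar f ξ μ m := by
    rw [← hξ.integral_pathFrom 0 hvm, ← integral_centeredBlock_sq hξ hf hf2 0 m,
      ← integral_condExp (pairSigma_le hξ.measurable (0 : ℕ) ((0 : ℕ) + m))
        (f := fun ω => centeredBlock f ξ μ 0 (0 + m) ω ^ 2)]
    refine integral_congr_ae ?_
    filter_upwards [hgk' 0] with ω hω
    rw [hω, hvk]
  have hvi' : Integrable v (processLaw ξ μ) := by
    rw [← memLp_one_iff_integrable, ← hξ.memLp_pathFrom_iff 0 hvm, memLp_one_iff_integrable]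
    exact hvi 0
  have hlln := herg.tendsto_integral_abs_average_sub hξ hm hvm hvi'
  rw [hvint] at hlln
  have hpair : ∀ k : ℕ, StronglyMeasurable[pairSigma ξ k (k + m)]
      (fun ω => v (pathFrom ξ k ω)) := by
    intro k
    simp only [hvk]
    exact ((hg.measurable.max measurable_const).comp
      (Measurable.of_comap_le le_rfl)).stronglyMeasurable
  -- `O u k` is the outside of block `k`: earlier blocks lie in the past of `k * m`, and later
  -- conditional variances depend on states at times from `k * m + m` to `u * m`.
  refine tendsto_integral_exp_sum_of_condExp (D := fun k => centeredBlock f ξ μ (k * m) (k * m + m))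
    (V := fun k ω => v (pathFrom ξ (k * m) ω))
    (O := fun u k => pastSigma ξ (k * m : ℕ) ⊔ windowSigma ξ (k * m + m : ℕ) (u * m : ℕ))
    ?_ ?_ ?_ ?_ ?_ ?_ ?_ (hL _ _) (hvi _) ?_ (centeredVar_nonneg m) hlln t
  · exact fun u k => sup_le (pastSigma_le hξ.measurable _) (windowSigma_le hξ.measurable _ _)
  · intro u j k hjk hku
    have h : j * m + m ≤ k * m := by
      rw [← Nat.succ_mul]; exact Nat.mul_le_mul_right m hjk
    exact ((stronglyMeasurable_centeredBlock hf (by omega) le_rfl le_rfl).mono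
      (windowSigma_le_pastSigma (by exact_mod_cast h))).mono le_sup_left
  · intro u j k hkj hju
    have h : k * m + m ≤ j * m := by
      rw [← Nat.succ_mul]; exact Nat.mul_le_mul_right m hkj
    have h' : j * m + m ≤ u * m := by
      rw [← Nat.succ_mul]; exact Nat.mul_le_mul_right m hju
    refine ((hpair (j * m)).mono (pairSigma_le_windowSigma ?_ ?_ ?_ ?_)).mono le_sup_right <;>
      omega
  · intro u k hku
    have h' : k * m + m ≤ u * m := by
      rw [← Nat.succ_mul]; exact Nat.mul_le_mul_right m hku
    exact hξ.condExp_outside_eq_zero (by omega) (by omega) ((hL _ _).integrable one_le_two)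
      (stronglyMeasurable_centeredBlock hf (by omega) le_rfl le_rfl)
      (condExp_centeredBlock_pair hξ hf hf2 _ _)
  · intro u k hku
    have h' : k * m + m ≤ u * m := by
      rw [← Nat.succ_mul]; exact Nat.mul_le_mul_right m hku
    have hp := hpair (k * m)
    have hg' := hgk' (k * m)
    simp only [← hvk] at hg'
    rw [← Nat.cast_add] at hp hg'
    refine hξ.condExp_outside_eq_zero (by omega) (by omega) ((hL _ _).integrable_sq.sub (hvi _))
      (((stronglyMeasurable_centeredBlock hf (by omega) le_rfl le_rfl).pow 2).sub
        (hp.mono (pairSigma_le_windowSigma le_rfl ?_ ?_ le_rfl))) ?_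
    · omega
    · omega
    · refine (condExp_sub (hL _ _).integrable_sq (hvi _) _).trans ?_
      rw [condExp_of_stronglyMeasurable (pairSigma_le hξ.measurable _ _) hp (hvi _)]
      filter_upwards [hg'] with ω hω
      rw [Pi.sub_apply, hω, sub_self, Pi.zero_apply]
  · intro k
    have h1 := (hξ.identDistrib_pathFrom (k * m)).comp hD.measurable
    have h2 := (hξ.identDistrib_pathFrom (0 * m)).comp hD.measurable
    exact (IdentDistrib.of_ae_eq (hL _ _).aemeasurable (hDk (k * m))).trans
      ((h1.trans h2.symm).trans (IdentDistrib.of_ae_eq (hL _ _).aemeasurable (hDk (0 * m))).symm)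
  · intro k
    have h1 := (hξ.identDistrib_pathFrom (k * m)).comp hvm.measurable
    have h2 := (hξ.identDistrib_pathFrom (0 * m)).comp hvm.measurable
    exact h1.trans h2.symm
  · exact fun k ω => le_max_right _ _

end BlockCLT

/-! ### Characteristic functions, Gaussian moments and truncation. -/

lemma norm_integral_exp_sub_le {Ω : Type*} [MeasurableSpace Ω] {μ : Measure Ω}
    [IsProbabilityMeasure μ] {A B : Ω → ℝ} (hA : Integrable A μ) (hB : Integrable B μ) :
    ‖∫ ω, Complex.exp ((A ω : ℂ) * Complex.I) ∂μ - ∫ ω, Complex.exp ((B ω : ℂ) * Complex.I) ∂μ‖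
      ≤ ∫ ω, |A ω - B ω| ∂μ := by
  have hi : ∀ {X : Ω → ℝ}, Integrable X μ →
      Integrable (fun ω => Complex.exp ((X ω : ℂ) * Complex.I)) μ := by
    intro X hX
    refine (integrable_const (1 : ℝ)).mono' ?_ (Eventually.of_forall fun ω =>
      (Complex.norm_exp_ofReal_mul_I _).le)
    exact (by fun_prop : Continuous fun x : ℝ => Complex.exp ((x : ℂ) * Complex.I))
      |>.comp_aestronglyMeasurable hX.aestronglyMeasurable
  rw [← integral_sub (hi hA) (hi hB)]
  refine norm_integral_le_of_norm_le (hA.sub hB).abs (Eventually.of_forall fun ω => ?_)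
  have e : Complex.exp ((A ω : ℂ) * Complex.I) - Complex.exp ((B ω : ℂ) * Complex.I)
      = Complex.exp ((B ω : ℂ) * Complex.I)
        * (Complex.exp (Complex.I * ((A ω - B ω : ℝ) : ℂ)) - 1) := by
    rw [mul_sub, ← Complex.exp_add, mul_one]
    congr 2
    push_cast
    ring
  rw [e, norm_mul, Complex.norm_exp_ofReal_mul_I, one_mul]
  exact Real.norm_exp_I_mul_ofReal_sub_one_le

/-- The source of the factor `π / 2` in the theorem. For `v ≠ 0`, evenness reduces the integral to
`Γ(1)`; for `v = 0` there is no density, only the unit mass. -/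
lemma integral_abs_gaussianReal (v : ℝ≥0) :
    ∫ x, |x| ∂gaussianReal 0 v = √(2 * v / Real.pi) := by
  rcases eq_or_ne v 0 with rfl | hv
  · simp [gaussianReal_zero_var]
  have hv' : (0 : ℝ) < v := by exact_mod_cast pos_iff_ne_zero.2 hv
  have hpi := Real.pi_pos
  rw [integral_gaussianReal_eq_integral_smul hv]
  have e : ∀ x : ℝ, gaussianPDFReal 0 v x • |x|
      = (fun y : ℝ => (√(2 * Real.pi * v))⁻¹ * (y * Real.exp (-(2 * v : ℝ)⁻¹ * y ^ 2))) |x| := by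
    intro x
    simp only [gaussianPDFReal, smul_eq_mul, sub_zero, sq_abs]
    have : -x ^ 2 / (2 * (v : ℝ)) = -(2 * v : ℝ)⁻¹ * x ^ 2 := by field_simp
    rw [this]
    ring
  simp_rw [e]
  rw [integral_comp_abs (f := fun y : ℝ => (√(2 * Real.pi * v))⁻¹
    * (y * Real.exp (-(2 * v : ℝ)⁻¹ * y ^ 2))), integral_const_mul]
  have h := integral_rpow_mul_exp_neg_mul_rpow (p := 2) (q := 1) (b := (2 * v : ℝ)⁻¹)
    (by norm_num) (by norm_num) (by positivity)
  simp only [Real.rpow_one, Real.rpow_two] at h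
  rw [h]
  have h2 : (2 * (v : ℝ))⁻¹ ^ (-(1 + 1 : ℝ) / 2) = 2 * v := by
    rw [show (-(1 + 1 : ℝ) / 2) = -1 by norm_num, Real.rpow_neg_one, inv_inv]
  rw [h2, show ((1 : ℝ) + 1) / 2 = 1 by norm_num, Real.Gamma_one]
  symm
  rw [Real.sqrt_eq_iff_mul_self_eq (by positivity) (by positivity)]
  have hs0 : 0 < √(2 * Real.pi * v) := by positivity
  field_simp
  exact Real.sq_sqrt (by positivity)

/-- Pointwise `|x| - min |x| K ≤ x² / K`. A common second moment bound therefore makes truncation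
uniformly harmless. -/
lemma abs_integral_abs_sub_integral_min_le {Ω : Type*} [MeasurableSpace Ω] {μ : Measure Ω}
    [IsProbabilityMeasure μ] {X : Ω → ℝ} (hX : MemLp X 2 μ) {C : ℝ} (hC : ∫ ω, X ω ^ 2 ∂μ ≤ C)
    {K : ℝ} (hK : 0 < K) : |∫ ω, |X ω| ∂μ - ∫ ω, min |X ω| K ∂μ| ≤ C / K := by
  have hXi := (hX.integrable one_le_two).abs
  have hmin : Integrable (fun ω => min |X ω| K) μ := hXi.inf (integrable_const K)
  rw [← integral_sub hXi hmin, abs_of_nonneg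
    (integral_nonneg fun ω => sub_nonneg.2 (min_le_left _ _))]
  calc ∫ ω, (|X ω| - min |X ω| K) ∂μ ≤ ∫ ω, X ω ^ 2 / K ∂μ := by
        refine integral_mono (hXi.sub hmin) (hX.integrable_sq.div_const K) fun ω => ?_
        rw [← sq_abs (X ω)]
        have := abs_nonneg (X ω)
        rcases le_total |X ω| K with h | h
        · simp only [min_eq_left h, sub_self]; positivity
        · simp only [min_eq_right h]
          rw [le_div_iff₀ hK]
          nlinarith
    _ = (∫ ω, X ω ^ 2 ∂μ) / K := integral_div _ _
    _ ≤ C / K := by gcongr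

/-- Convergence in distribution with bounded second moments implies convergence of the first
absolute moments. -/
lemma tendsto_integral_abs_of_tendstoInDistribution {Ω Ω' : Type*} [MeasurableSpace Ω]
    [MeasurableSpace Ω'] {μ : Measure Ω} [IsProbabilityMeasure μ] {ν : Measure Ω'}
    [IsProbabilityMeasure ν] {X : ℕ → Ω → ℝ} {Z : Ω' → ℝ}
    (h : TendstoInDistribution X atTop Z (fun _ => μ) ν) (hX : ∀ n, MemLp (X n) 2 μ)
    (hZ : MemLp Z 2 ν) {C : ℝ} (hC : ∀ᶠ n in atTop, ∫ ω, X n ω ^ 2 ∂μ ≤ C)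
    (hCZ : ∫ ω, Z ω ^ 2 ∂ν ≤ C) :
    Tendsto (fun n => ∫ ω, |X n ω| ∂μ) atTop (𝓝 (∫ ω, |Z ω| ∂ν)) := by
  have hC0 : 0 ≤ C := (integral_nonneg fun _ => sq_nonneg _).trans hCZ
  rw [Metric.tendsto_atTop']
  intro ε hε
  -- `C + 1` keeps `K` positive when `C = 0` and makes `C / K < ε / 3` strict.
  set K : ℝ := 3 * (C + 1) / ε with hK
  have hK0 : 0 < K := by positivity
  have hCK : C / K < ε / 3 := by
    rw [div_lt_iff₀ hK0, hK]
    field_simp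
    linarith
  let φ : BoundedContinuousFunction ℝ ℝ := BoundedContinuousFunction.ofNormedAddCommGroup
    (fun x => min |x| K) (by fun_prop) K fun x => by
      rw [Real.norm_of_nonneg (by positivity)]; exact min_le_right _ _
  have hlim := ProbabilityMeasure.tendsto_iff_forall_integral_tendsto.1 h.tendsto φ
  have e1 : ∀ n, ∫ x, φ x ∂(μ.map (X n)) = ∫ ω, min |X n ω| K ∂μ := fun n =>
    integral_map (hX n).aemeasurable φ.continuous.aestronglyMeasurable
  have e2 : ∫ x, φ x ∂(ν.map Z) = ∫ ω, min |Z ω| K ∂ν :=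
    integral_map hZ.aemeasurable φ.continuous.aestronglyMeasurable
  simp only [ProbabilityMeasure.coe_mk, e1, e2] at hlim
  have hev := (Metric.tendsto_nhds.1 hlim (ε / 3) (by positivity)).and hC
  obtain ⟨N, hN⟩ := eventually_atTop.1 hev
  refine ⟨N, fun n hn => ?_⟩
  obtain ⟨h1, h2⟩ := hN n hn.le
  have h3 := abs_integral_abs_sub_integral_min_le (hX n) h2 hK0
  have h4 := abs_integral_abs_sub_integral_min_le hZ hCZ hK0
  rw [Real.dist_eq] at h1 ⊢
  rw [abs_lt] at h1 ⊢
  rw [abs_le] at h3 h4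
  constructor <;> linarith

lemma tendsto_natDiv_div (m : ℕ) (hm : 1 ≤ m) :
    Tendsto (fun n : ℕ => ((n / m : ℕ) : ℝ) / n) atTop (𝓝 (1 / m)) := by
  have hm' : (0 : ℝ) < m := by exact_mod_cast hm
  have h1 : Tendsto (fun n : ℕ => ((n % m : ℕ) : ℝ) / n) atTop (𝓝 0) := by
    refine squeeze_zero (fun n => by positivity) (fun n => ?_)
      (tendsto_const_nhds.div_atTop tendsto_natCast_atTop_atTop : Tendsto
        (fun n : ℕ => (m : ℝ) / n) atTop (𝓝 0))
    gcongr
    exact (Nat.mod_lt n hm).le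
  have h2 := (h1.const_sub 1).div_const (m : ℝ)
  rw [sub_zero] at h2
  refine h2.congr' ?_
  filter_upwards [eventually_gt_atTop 0] with n hn
  have hn' : (0 : ℝ) < n := by exact_mod_cast hn
  have h3 : (n : ℝ) = m * (n / m : ℕ) + (n % m : ℕ) := by exact_mod_cast (Nat.div_add_mod n m).symm
  field_simp
  linarith

/-! ### The central limit theorem for centered sums. -/

section CentralLimit

variable {Ω S : Type*} [MeasurableSpace Ω] [MeasurableSpace S]
  {f : S → ℝ} {ξ : ℤ → Ω → S} {μ : Measure Ω} [IsProbabilityMeasure μ]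

/-- Comparison of the characteristic function of a centered block with that of the normalized sum
of its centered subblocks of length `m`. -/
lemma norm_integral_exp_centeredBlock_sub_le (hξ : IsStationaryMarkovChain ξ μ)
    (hf : Measurable f) (hf2 : MemLp f 2 (μ.map (ξ 0))) {n m : ℕ} (hn : 0 < n) (t : ℝ) :
    ‖∫ ω, Complex.exp (((t / √n * centeredBlock f ξ μ 0 n ω : ℝ) : ℂ) * Complex.I) ∂μ
      - ∫ ω, Complex.exp (((t / √m / √(n / m : ℕ) * ∑ k ∈ Finset.range (n / m),
          centeredBlock f ξ μ (k * m) (k * m + m) ω : ℝ) : ℂ) * Complex.I) ∂μ‖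
      ≤ |t| * √(centeredVar f ξ μ n / n - ((n / m : ℕ) : ℝ) / n * centeredVar f ξ μ m)
        + |t| * |1 - (√(m * (((n / m : ℕ) : ℝ) / n)))⁻¹| * (2 * √(centeredVar f ξ μ n / n)) := by
  have hn' : (0 : ℝ) < n := by exact_mod_cast hn
  have hsn : 0 < √(n : ℝ) := Real.sqrt_pos.2 hn'
  have hL := memLp_centeredBlock hξ hf hf2
  set u := n / m with hu
  set Y := centeredBlock f ξ μ 0 n with hY
  set M : Ω → ℝ := fun ω => ∑ k ∈ Finset.range u, centeredBlock f ξ μ (k * m) (k * m + m) ω with hM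
  have hYL : MemLp Y 2 μ := hL 0 n
  have hML : MemLp M 2 μ := memLp_finsetSum _ fun k _ => hL _ _
  have hYi := hYL.integrable one_le_two
  have hMi := hML.integrable one_le_two
  have hb := integral_centeredBlock_sub_sum_blocks_sq hξ hf hf2 (n := n) (m := m) (u := u)
    (Nat.div_mul_le_self n m)
  have h1 : ∫ ω, |Y ω - M ω| ∂μ ≤ √(centeredVar f ξ μ n - u * centeredVar f ξ μ m) := by
    rw [← hb]
    exact integral_abs_le_sqrt (hYL.sub hML)
  have h2 : ∫ ω, |Y ω| ∂μ ≤ √(centeredVar f ξ μ n) := integral_abs_le_sqrt hYL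
  have h3 : ∫ ω, |M ω| ∂μ ≤ 2 * √(centeredVar f ξ μ n) := by
    have h4 : √(centeredVar f ξ μ n - u * centeredVar f ξ μ m) ≤ √(centeredVar f ξ μ n) := by
      refine Real.sqrt_le_sqrt ?_
      have := centeredVar_nonneg (f := f) (ξ := ξ) (μ := μ) m
      have : 0 ≤ (u : ℝ) * centeredVar f ξ μ m := by positivity
      linarith
    have h5 : ∫ ω, |M ω| ∂μ ≤ ∫ ω, (|Y ω - M ω| + |Y ω|) ∂μ := by
      refine integral_mono hMi.abs ((hYi.sub hMi).abs.add hYi.abs) fun ω => ?_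
      have := abs_sub_abs_le_abs_sub (M ω) (Y ω)
      rw [abs_sub_comm] at this
      simp only
      linarith
    have h6 : Integrable (fun ω => |Y ω - M ω|) μ := (hYi.sub hMi).abs
    rw [integral_add h6 hYi.abs] at h5
    linarith
  -- The intermediate variable is `M / √n`: one error is the `L²` distance from `Y` to `M`, the
  -- other the change of normalization from `√n` to `√(m u)`.
  refine (norm_sub_le_norm_sub_add_norm_sub _
    (∫ ω, Complex.exp (((t / √n * M ω : ℝ) : ℂ) * Complex.I) ∂μ) _).trans (add_le_add ?_ ?_)
  · refine (norm_integral_exp_sub_le (hYi.const_mul _) (hMi.const_mul _)).trans ?_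
    simp_rw [← mul_sub, abs_mul]
    rw [integral_const_mul, abs_div, abs_of_pos hsn, div_mul_eq_mul_div, mul_div_assoc]
    gcongr
    have e : centeredVar f ξ μ n / n - (u : ℝ) / n * centeredVar f ξ μ m
        = (centeredVar f ξ μ n - u * centeredVar f ξ μ m) / n := by ring
    rw [e, Real.sqrt_div' _ hn'.le]
    gcongr
  · refine (norm_integral_exp_sub_le (hMi.const_mul _) (hMi.const_mul _)).trans ?_
    simp_rw [← sub_mul, abs_mul]
    rw [integral_const_mul]
    -- For `u = 0` both sides equal `t / √n`, by the convention for division by zero.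
    have e : t / √n - t / √m / √u = t / √n * (1 - (√(m * ((u : ℝ) / n)))⁻¹) := by
      rw [← mul_div_assoc, Real.sqrt_div' _ hn'.le, Real.sqrt_mul (Nat.cast_nonneg m), inv_div,
        mul_sub, mul_one, div_mul_div_comm, mul_comm t, mul_div_mul_left _ _ hsn.ne', div_div]
    rw [e, abs_mul, abs_div, abs_of_pos hsn, Real.sqrt_div' _ hn'.le]
    calc |t| / √n * |1 - (√(m * ((u : ℝ) / n)))⁻¹| * ∫ ω, |M ω| ∂μ
        ≤ |t| / √n * |1 - (√(m * ((u : ℝ) / n)))⁻¹| * (2 * √(centeredVar f ξ μ n)) := by gcongr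
      _ = _ := by ring

/-- The central limit theorem for the partial sums centered by their conditional expectation given
the initial and final states. -/
lemma tendsto_integral_exp_centeredBlock (hξ : IsStationaryMarkovChain ξ μ)
    (herg : IsTotallyErgodic ξ μ) (hf : Measurable f) (hf2 : MemLp f 2 (μ.map (ξ 0))) {L : ℝ≥0}
    (hlim : Tendsto (fun n : ℕ => centeredVar f ξ μ n / n) atTop (𝓝 (L : ℝ)))
    (hle : ∀ n : ℕ, 1 ≤ n → centeredVar f ξ μ n / n ≤ L) (t : ℝ) :
    Tendsto (fun n : ℕ => ∫ ω, Complex.exp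
        (((t / √n * centeredBlock f ξ μ 0 n ω : ℝ) : ℂ) * Complex.I) ∂μ)
      atTop (𝓝 ((Real.exp (-(t ^ 2 * L / 2)) : ℝ) : ℂ)) := by
  set a := centeredVar f ξ μ with ha
  have ha0 : ∀ n, 0 ≤ a n := centeredVar_nonneg
  rw [Metric.tendsto_atTop']
  intro ε hε
  -- For fixed `m` and `n → ∞`, the surviving error has two parts: the Pythagorean defect, and the
  -- gap between the limiting variances `a m / m` and `L`. Both vanish as `m` grows.
  have hB : Tendsto (fun m : ℕ => |t| * √(L - a m / m) + t ^ 2 / 2 * (L - a m / m))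
      atTop (𝓝 0) := by
    have h1 := hlim.const_sub (L : ℝ)
    rw [sub_self] at h1
    have h2 := (h1.sqrt.const_mul |t|).add (h1.const_mul (t ^ 2 / 2))
    simpa using h2
  obtain ⟨m, hBm, hm⟩ := ((hB.eventually_lt_const hε).and (eventually_ge_atTop 1)).exists
  have hm' : (0 : ℝ) < m := by exact_mod_cast hm
  have hu := tendsto_natDiv_div m hm
  have hdiv : Tendsto (fun n : ℕ => n / m) atTop atTop :=
    Nat.tendsto_div_const_atTop (by omega)
  have hclt := (tendsto_integral_exp_sum_centeredBlock hξ herg hf hf2 hm (t / √m)).comp hdiv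
  rw [tendsto_iff_norm_sub_tendsto_zero] at hclt
  have h1 : Tendsto (fun n : ℕ => |t| * √(a n / n - ((n / m : ℕ) : ℝ) / n * a m)) atTop
      (𝓝 (|t| * √(L - a m / m))) := by
    have := (hlim.sub (hu.mul_const (a m))).sqrt.const_mul |t|
    rwa [one_div, inv_mul_eq_div] at this
  have h2 : Tendsto (fun n : ℕ => |t| * |1 - (√(m * (((n / m : ℕ) : ℝ) / n)))⁻¹|
      * (2 * √(a n / n))) atTop (𝓝 0) := by
    have h3 := hu.const_mul (m : ℝ)
    rw [mul_one_div_cancel hm'.ne'] at h3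
    have h4 := h3.sqrt
    rw [Real.sqrt_one] at h4
    have h5 := ((h4.inv₀ one_ne_zero).const_sub 1).abs.const_mul |t|
    simpa using h5.mul (hlim.sqrt.const_mul 2)
  have hsum := ((h1.add h2).add hclt).add_const (t ^ 2 / 2 * (L - a m / m))
  rw [add_zero, add_zero] at hsum
  obtain ⟨N, hN⟩ := eventually_atTop.1 (hsum.eventually_lt_const hBm)
  refine ⟨max N 0, fun n hn => ?_⟩
  have hn0 : 0 < n := lt_of_le_of_lt (le_max_right N 0) hn
  refine lt_of_le_of_lt ?_ (hN n ((le_max_left N 0).trans hn.le))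
  rw [dist_eq_norm]
  refine (norm_sub_le_norm_sub_add_norm_sub _
    ((Real.exp (-((t / √m) ^ 2 * a m / 2)) : ℝ) : ℂ) _).trans (add_le_add ?_ ?_)
  · refine (norm_sub_le_norm_sub_add_norm_sub _ _ _).trans (add_le_add
      (norm_integral_exp_centeredBlock_sub_le hξ hf hf2 hn0 t) le_rfl)
  · rw [← Complex.ofReal_sub, Complex.norm_real, Real.norm_eq_abs]
    have hp : 0 ≤ (t / √m) ^ 2 * a m / 2 := by have := ha0 m; positivity
    refine (abs_exp_neg_sub_exp_neg_le hp (by positivity)).trans (le_of_eq ?_)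
    have h3 := hle m hm
    have e : (t / √m) ^ 2 * a m / 2 - t ^ 2 * L / 2 = -(t ^ 2 / 2 * (L - a m / m)) := by
      rw [div_pow, Real.sq_sqrt hm'.le]
      ring
    rw [e, abs_neg, abs_of_nonneg (mul_nonneg (by positivity) (sub_nonneg.2 h3))]

end CentralLimit

/-! ### The theorem. -/

theorem corollary3 {Ω S : Type*} [MeasurableSpace Ω] [MeasurableSpace S]
    (μ : Measure Ω) [IsProbabilityMeasure μ]
    (ξ : ℤ → Ω → S) (hξ : IsStationaryMarkovChain ξ μ) (herg : IsTotallyErgodic ξ μ)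
    (f : S → ℝ) (hf : Measurable f)
    (hf2 : MemLp f 2 (μ.map (ξ 0))) (hf0 : ∫ x, f x ∂(μ.map (ξ 0)) = 0)
    (hvar : ∃ C : ℝ, ∀ n : ℕ, 1 ≤ n → (∫ ω, (partialSum f ξ n ω) ^ 2 ∂μ) / n ≤ C)
    (hcond : TendstoInMeasure μ (fun (n : ℕ) ω => endpointCondExp f ξ μ n ω / √(n : ℝ))
      atTop (fun _ => (0 : ℝ))) :
    ∃ σ2 : ℝ≥0,
      Tendsto (fun n : ℕ => Real.pi / (2 * (n : ℝ)) * (∫ ω, |partialSum f ξ n ω| ∂μ) ^ 2)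
        atTop (𝓝 (σ2 : ℝ)) ∧
      Tendsto (fun n : ℕ =>
          (1 / (n : ℝ)) * ∫ ω, (partialSum f ξ n ω - endpointCondExp f ξ μ n ω) ^ 2 ∂μ)
        atTop (𝓝 (σ2 : ℝ)) ∧
      TendstoInDistribution (fun (n : ℕ) ω => partialSum f ξ n ω / √(n : ℝ)) atTop
        (id : ℝ → ℝ) (fun _ => μ) (gaussianReal 0 σ2) := by
  obtain ⟨C, hC⟩ := hvar
  obtain ⟨L, hlim, hle⟩ := exists_tendsto_div_of_superadditive
    (a := centeredVar f ξ μ) centeredVar_nonneg (centeredVar_add_le hξ hf hf2) (C := C)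
    fun n hn => (div_le_div_of_nonneg_right (centeredVar_le hξ hf hf2 n) (Nat.cast_nonneg n)).trans
      (hC n hn)
  have hS : ∀ n, MemLp (partialSum f ξ n) 2 μ := fun n => memLp_blockSum hξ hf hf2 0 n
  have hY := memLp_centeredBlock hξ hf hf2
  have hE : ∀ n : ℕ, MemLp (endpointCondExp f ξ μ n) 2 μ := fun n => (hS n).condExp one_le_two
  have hYE : ∀ (n : ℕ) ω,
      partialSum f ξ n ω - endpointCondExp f ξ μ n ω = centeredBlock f ξ μ 0 n ω := by
    intro n ω
    simp [centeredBlock, endpointCondExp, partialSum_eq_blockSum]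
  have hYm : ∀ n : ℕ, AEMeasurable (fun ω => centeredBlock f ξ μ 0 n ω / √(n : ℝ)) μ :=
    fun n => (hY 0 n).aemeasurable.div_const _
  have hYd : TendstoInDistribution (fun (n : ℕ) ω => centeredBlock f ξ μ 0 n ω / √(n : ℝ)) atTop
      (id : ℝ → ℝ) (fun _ => μ) (gaussianReal 0 L) := by
    refine ⟨hYm, aemeasurable_id, ProbabilityMeasure.tendsto_of_tendsto_charFun fun t => ?_⟩
    simp only [ProbabilityMeasure.coe_mk, Measure.map_id, charFun_gaussianReal]
    have h := tendsto_integral_exp_centeredBlock hξ herg hf hf2 hlim hle t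
    have e1 : ((Real.exp (-(t ^ 2 * L / 2)) : ℝ) : ℂ)
        = Complex.exp (t * (0 : ℝ) * Complex.I - L * t ^ 2 / 2) := by
      push_cast
      congr 1
      ring
    rw [e1] at h
    refine h.congr fun n => ?_
    rw [charFun_apply_real, integral_map (hYm n) (by fun_prop)]
    refine integral_congr_ae (Eventually.of_forall fun ω => ?_)
    simp only
    congr 2
    push_cast
    ring
  have hSd : TendstoInDistribution (fun (n : ℕ) ω => partialSum f ξ n ω / √(n : ℝ)) atTop
      (id : ℝ → ℝ) (fun _ => μ) (gaussianReal 0 L) := by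
    -- Slutsky: the removed conditional expectation is negligible at scale `√n`.
    have h := hYd.add_of_tendstoInMeasure_const hcond
      fun n => (hE n).aemeasurable.div_const _
    simp only [id, add_zero] at h
    convert! h using 2 with n
    ext ω
    rw [Pi.add_apply, ← hYE n ω]
    ring
  have hZ : MemLp (id : ℝ → ℝ) 2 (gaussianReal 0 L) := memLp_id_gaussianReal 2
  have hSn : ∀ n : ℕ, MemLp (fun ω => partialSum f ξ n ω / √(n : ℝ)) 2 μ := fun n => by
    simpa only [div_eq_mul_inv] using (hS n).mul_const (√(n : ℝ))⁻¹
  -- One constant must bound the second moments of the sequence and of the Gaussian limit.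
  have hmom := tendsto_integral_abs_of_tendstoInDistribution hSd hSn hZ
    (C := max C (∫ x, id x ^ 2 ∂gaussianReal 0 L)) (by
      filter_upwards [eventually_ge_atTop 1] with n hn
      refine le_trans (le_of_eq ?_) ((hC n hn).trans (le_max_left _ _))
      simp_rw [div_pow, Real.sq_sqrt (Nat.cast_nonneg (α := ℝ) n)]
      exact integral_div _ _) (le_max_right _ _)
  simp only [id, integral_abs_gaussianReal] at hmom
  refine ⟨L, ?_, ?_, hSd⟩
  · have h := (hmom.pow 2).const_mul (Real.pi / 2)
    rw [Real.sq_sqrt (by positivity)] at h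
    have e : Real.pi / 2 * (2 * L / Real.pi) = L := by
      have := Real.pi_pos
      field_simp
    rw [e] at h
    refine h.congr fun n => ?_
    simp_rw [abs_div, abs_of_nonneg (Real.sqrt_nonneg _)]
    rw [integral_div, div_pow, Real.sq_sqrt (Nat.cast_nonneg n)]
    ring
  · refine hlim.congr fun n => ?_
    simp_rw [hYE]
    rw [one_div, inv_mul_eq_div]
    rfl
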